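/- **Setting.** Let $\mathfrak g$ be the untwisted affinization of a simple complex Lie algebra $\mathfrak g_o$ of simply-laced type and rank $\ell$. Let $\Pi=\{a_1,\dots,a_{\ell+1}\}$ be its simple roots, $a_i^\vee$ the simple coroots, $Q^\vee=\bigoplus_i\mathbb Z a_i^\vee$, $Q^\vee_-=-\sum_i\mathbb Z_{\ge0}a_i^\vee$, $\mathbf c$ the minimal positive imaginary coroot, and $W$ the affine Weyl group, generated by the simple reflections $w_a$, $a\in\Pi$. Let $v$ be a formal variable, and write $\mathcal Q^{fin}_v=\mathbb C[v^{-1}][[Q^\vee_-]]$ for the ring of formal series $\sum_{\gamma\in Q^\vee_-}c_\gamma e^\gamma$ with $c_\gamma\in\mathbb C[v^{-1}]$. It is contained in the ring $\mathcal L$ of formal series $\sum_{\gamma\in Q^\vee}c_\gamma e^{\gamma}$, $c_\gamma\in\mathbb C[v^{-1}]$, with support in a finite union of cones $\gamma_k+Q^\vee_-$. Rational functions in the $e^\gamma$ and $v^{-1}$ are expanded in negative powers of the coroots: $f\in\mathcal L$ is the expansion of $n/d$ if $df=n$. For $w\in W$ and $f\in\mathcal L$ we say that $w f$ is defined and equal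 to $g\in\mathcal L$ if, for some nonzero $d\in\mathbb C[v^{-1}][Q^\vee]$, termwise application of $w$ (that is, $e^\gamma\mapsto e^{w\gamma}$) to $df$ gives $(wd)\,g$. Formal sums $\sum_{u\in W}F_u[u]$, possibly infinite, with $F_u\in\mathcal L$ are multiplied on the left and on the right by elements of the group algebra $R[W]$ over the field $R$ of rational functions, according to $[w]\,r=(wr)\,[w]$. For $a\in\Pi$ put $$\mathbf c(a^\vee)=\frac{1-v^{-1}e^{-a^\vee}}{1-e^{a^\vee}},\qquad \mathbf b(a^\vee)=\frac{v^{-1}-1}{1-e^{a^\vee}},\qquad T_a=\mathbf c(a^\vee)[w_a]+\mathbf b(a^\vee)[1]\in R[W],$$ and $T_w=T_{a_{i_1}}\cdots T_{a_{i_r}}$ for any reduced decomposition $w=w_{a_{i_1}}\cdots w_{a_{i_r}}$. Write $T_w=\sum_u C_u(w)[u]$, with the coefficients expanded in $\mathcal L$, and let $$\mathcal P=\sum_{w\in W}T_w=\sum_{u\in W}C_u\,[u],\qquad C_u=\sum_{w\in W}C_u(w).$$ Finally let $\mathfrak D_v=\prod_{\gamma}(1-v^{-1}e^{-\gamma})^{m(\gamma)}$,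 the product being over all positive coroots $\gamma$, real and imaginary (the latter are the $n\mathbf c$, $n\ge1$), with $m(\gamma)=1$ if $\gamma$ is real and $m(\gamma)=\ell$ if $\gamma$ is imaginary. **Lemma.** The element $\mathcal P$ is well defined: $T_w$ does not depend on the reduced decomposition, its coefficients have expansions in $\mathcal L$, for every $u\in W$ and $\gamma\in Q^\vee$ only finitely many $C_u(w)$ contain $e^\gamma$, and $C_u\in\mathcal Q^{fin}_v$ for every $u$. Moreover $\mathfrak D_v$ is invertible, $\mathfrak D_v^{-1}C_u\in\mathcal Q^{fin}_v$ for all $u$, and for every $a\in\Pi$ all the products below are defined and 1. $T_a\mathcal P=v^{-1}\mathcal P$; 2. $\mathcal P\,T_a=v^{-1}\mathcal P$; 3. $[w_a]\,\mathcal P=\dfrac{1-v^{-1}e^{a^\vee}}{1-v^{-1}e^{-a^\vee}}\;\mathcal P$; 4. $\mathfrak D_v^{-1}\mathcal P$ is $W$-invariant: $[w]\,\mathfrak D_v^{-1}\mathcal P=\mathfrak D_v^{-1}\mathcal P$ for every $w\in W$. -/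

import Mathlib

open Polynomial

noncomputable section

/-!
# Demazure-Lusztig operators and the symmetrizer for simply-laced untwisted affine types

`ℂ[X]` plays the role of `ℂ[v⁻¹]`: the variable `X` is `v⁻¹`.
The coroot lattice `Q^∨` is `I → ℤ`, with the simple coroot `a_i^∨` equal to `Pi.single i 1`.
-/

/-- An indecomposable symmetric generalized Cartan matrix of affine type, with the minimal
imaginary coroot `c`.  Affine type means corank one with a strictly positive null vector; here
`c` is the strictly positive generator of the integral kernel.  The symmetric affine generalized
Cartan matrices are exactly those of the untwisted affinizations of the simple Lie algebras of
simply-laced type (`A_ℓ⁽¹⁾`, `D_ℓ⁽¹⁾`, `E_ℓ⁽¹⁾`), with `|I| = ℓ + 1`.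
The entry `A i j` is `⟨a_j, a_i^∨⟩ = ⟨a_i, a_j^∨⟩`. -/
structure AffineDatum (I : Type*) [Fintype I] [DecidableEq I] where
  A : Matrix I I ℤ
  nonempty : Nonempty I
  symm : A.IsSymm
  diag : ∀ i, A i i = 2
  offDiag : ∀ i j, i ≠ j → A i j ≤ 0
  indecomposable : ∀ s : Set I, s.Nonempty → sᶜ.Nonempty → ∃ i ∈ s, ∃ j ∈ sᶜ, A i j ≠ 0
  c : I → ℤ
  c_pos : ∀ i, 0 < c i
  A_mulVec_c : A.mulVec c = 0
  ker_eq : ∀ x : I → ℤ, A.mulVec x = 0 → ∃ n : ℤ, x = n • c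

/-- The group algebra `ℂ[v⁻¹][Q^∨]`; `e^γ` is `AddMonoidAlgebra.single γ 1`. -/
abbrev CorootAlg (I : Type*) : Type _ := AddMonoidAlgebra ℂ[X] (I → ℤ)

/-- The field of rational functions in the `e^γ` (and `v⁻¹`). -/
abbrev RatFun (I : Type*) : Type _ := FractionRing (CorootAlg I)

/-- Formal series `∑ c_γ e^γ` over `Q^∨` with coefficients in `ℂ[v⁻¹]` whose support lies in a
finite union of cones `{γ ∣ γ ≤ γ_k}` for the dominance order: in the reversed order on
`I → ℤ`, these are exactly the partially well-ordered supports.  The coefficient of `e^γ` in `f`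
is `f.coeff (OrderDual.toDual γ)`. -/
abbrev CorootSeries (I : Type*) : Type _ := HahnSeries (I → ℤ)ᵒᵈ ℂ[X]

/-- The exponential `e^γ` as a formal series. -/
def expS {I : Type*} (γ : I → ℤ) : CorootSeries I := HahnSeries.single (OrderDual.toDual γ) 1

/-- The element `v⁻¹` of the ring of formal series. -/
def vInvS (I : Type*) : CorootSeries I := HahnSeries.C (X : ℂ[X])

/-- The subset `ℂ[v⁻¹][[Q^∨_-]]` of series in the `e^{-γ}`, `γ ∈ Q^∨_+`. -/
def QFin (I : Type*) : Set (CorootSeries I) :=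
  {f | ∀ γ : I → ℤ, f.coeff (OrderDual.toDual γ) ≠ 0 → γ ≤ 0}

/-- The inclusion of `ℂ[v⁻¹][Q^∨]` in the formal series, `e^γ ↦ e^γ`. -/
def toSeries (I : Type*) : CorootAlg I →ₐ[ℂ[X]] CorootSeries I :=
  AddMonoidAlgebra.lift ℂ[X] (CorootSeries I) (I → ℤ)
    { toFun := fun γ => expS γ.toAdd
      map_one' := rfl
      map_mul' := fun γ δ => by
        simp only [expS, HahnSeries.single_mul_single, toAdd_mul, toDual_add, mul_one] }

/-- `f` is the expansion, in negative powers of the coroots, of the rational function `r`: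
if `r = n / d` then `d f = n` as formal series. -/
def IsExpansion {I : Type*} [Fintype I] (r : RatFun I) (f : CorootSeries I) : Prop :=
  ∃ n d : CorootAlg I, d ≠ 0 ∧
    r * algebraMap (CorootAlg I) (RatFun I) d = algebraMap (CorootAlg I) (RatFun I) n ∧
    f * toSeries I d = toSeries I n

/-- The exponential `e^γ` as a rational function. -/
def expR {I : Type*} (γ : I → ℤ) : RatFun I :=
  algebraMap (CorootAlg I) (RatFun I) (AddMonoidAlgebra.single γ 1)

/-- The element `v⁻¹` of the field of rational functions. -/
def vInvR (I : Type*) : RatFun I :=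
  algebraMap (CorootAlg I) (RatFun I) (AddMonoidAlgebra.single 0 X)

/-- `𝐜(γ) = (1 - v⁻¹ e^{-γ}) / (1 - e^γ)`. -/
def cFun {I : Type*} [Fintype I] (γ : I → ℤ) : RatFun I :=
  (1 - vInvR I * expR (-γ)) / (1 - expR γ)

/-- `𝐛(γ) = (v⁻¹ - 1) / (1 - e^γ)`. -/
def bFun {I : Type*} [Fintype I] (γ : I → ℤ) : RatFun I :=
  (vInvR I - 1) / (1 - expR γ)

theorem isPWO_Iic_zero {I : Type*} [Fintype I] : {x : (I → ℤ)ᵒᵈ | OrderDual.ofDual x ≤ 0}.IsPWO := by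
  let φ : (I → ℕ) → (I → ℤ)ᵒᵈ := fun n => OrderDual.toDual (fun i => -(n i : ℤ))
  have hφ : Monotone φ := by
    intro m n hmn
    change (fun i => -(n i : ℤ)) ≤ fun i => -(m i : ℤ)
    intro i
    exact neg_le_neg (Int.ofNat_le.mpr (hmn i))
  refine ((Set.isPWO_of_wellQuasiOrderedLE (Set.univ : Set (I → ℕ))).image_of_monotone hφ).mono ?_
  intro x hx
  refine ⟨fun i => (-(OrderDual.ofDual x i)).toNat, trivial, ?_⟩
  apply OrderDual.ofDual.injective
  funext i
  have : OrderDual.ofDual x i ≤ 0 := hx i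
  change -(((-(OrderDual.ofDual x i)).toNat : ℕ) : ℤ) = OrderDual.ofDual x i
  omega

namespace AffineDatum

variable {I : Type*} [Fintype I] [DecidableEq I] (D : AffineDatum I)

/-- The simple coroot `a_i^∨`. -/
def simpleCoroot (_D : AffineDatum I) (i : I) : I → ℤ := Pi.single i 1

/-- The simple root `a_i` as a linear form on the coroot lattice. -/
def simpleRoot (i : I) : Module.Dual ℤ (I → ℤ) := (LinearMap.proj i).comp D.A.mulVecLin

theorem simpleRoot_simpleCoroot (i : I) : D.simpleRoot i (D.simpleCoroot i) = 2 := by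
  simp [simpleRoot, simpleCoroot, D.diag]

/-- The simple reflection `w_i : x ↦ x - ⟨a_i, x⟩ a_i^∨`. -/
def simpleReflection (i : I) : (I → ℤ) ≃ₗ[ℤ] (I → ℤ) :=
  Module.reflection (D.simpleRoot_simpleCoroot i)

/-- The affine Weyl group, generated by the simple reflections. -/
def weylGroup : Subgroup ((I → ℤ) ≃ₗ[ℤ] (I → ℤ)) :=
  Subgroup.closure (Set.range D.simpleReflection)

/-- The simple reflection `w_i` as an element of the Weyl group. -/
def refl (i : I) : D.weylGroup :=
  ⟨D.simpleReflection i, Subgroup.subset_closure ⟨i, rfl⟩⟩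

/-- The action of `W` on `ℂ[v⁻¹][Q^∨]`, `w e^γ = e^{wγ}`. -/
instance algAction : MulSemiringAction D.weylGroup (CorootAlg I) where
  smul w f := AddMonoidAlgebra.domCongr ℂ[X] ℂ[X] w.1.toAddEquiv f
  one_smul f := by
    change AddMonoidAlgebra.domCongr ℂ[X] ℂ[X] _ f = f
    ext γ
    simp
    rfl
  mul_smul w w' f := by
    change AddMonoidAlgebra.domCongr ℂ[X] ℂ[X] _ f =
      AddMonoidAlgebra.domCongr ℂ[X] ℂ[X] _ (AddMonoidAlgebra.domCongr ℂ[X] ℂ[X] _ f)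
    ext γ
    simp
    rfl
  smul_zero w := map_zero (AddMonoidAlgebra.domCongr ℂ[X] ℂ[X] w.1.toAddEquiv)
  smul_add w := map_add (AddMonoidAlgebra.domCongr ℂ[X] ℂ[X] w.1.toAddEquiv)
  smul_one w := map_one (AddMonoidAlgebra.domCongr ℂ[X] ℂ[X] w.1.toAddEquiv)
  smul_mul w := map_mul (AddMonoidAlgebra.domCongr ℂ[X] ℂ[X] w.1.toAddEquiv)

/-- The induced action of `W` on rational functions. -/
instance ratAction : MulSemiringAction D.weylGroup (RatFun I) :=
  IsFractionRing.mulSemiringAction D.weylGroup (CorootAlg I) (RatFun I)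

/-- The group algebra `R[W]` of `W` over the rational functions, in which
`(r [w]) (s [w']) = r (w s) [w w']`. -/
abbrev RW : Type _ := SkewMonoidAlgebra (RatFun I) D.weylGroup

/-- The element `T_a = 𝐜(a^∨) [w_a] + 𝐛(a^∨) [1]` for `a = a_i`. -/
def T (i : I) : D.RW :=
  SkewMonoidAlgebra.single (D.refl i) (cFun (D.simpleCoroot i)) +
    SkewMonoidAlgebra.single 1 (bFun (D.simpleCoroot i))

/-- The element of `W` spelled by a word in the simple reflections. -/
def wordProd (l : List I) : D.weylGroup := (l.map D.refl).prod

/-- The word `l` is a reduced decomposition. -/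
def IsReduced (l : List I) : Prop :=
  ∀ l' : List I, D.wordProd l' = D.wordProd l → l.length ≤ l'.length

/-- The formal sum `∑_u P_u [u]` is the symmetrizer `∑_w T_w`.  Here `T_w = T_{w_1} ⋯ T_{w_r}`
for every reduced decomposition of `w`, its coefficients are expanded in negative powers of
the coroots as `T_w = ∑_u C_u(w) [u]`, and `P_u = ∑_w C_u(w)`, where every `e^γ` receives
a contribution from only finitely many `w`. -/
def IsSymmetrizer (P : D.weylGroup → CorootSeries I) : Prop :=
  ∃ C : D.weylGroup → D.weylGroup → CorootSeries I,
    (∀ l : List I, D.IsReduced l → ∀ u : D.weylGroup,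
      IsExpansion ((l.map D.T).prod.coeff u) (C u (D.wordProd l))) ∧
    ∀ (u : D.weylGroup) (γ : I → ℤ),
      {w : D.weylGroup | (C u w).coeff (OrderDual.toDual γ) ≠ 0}.Finite ∧
      (P u).coeff (OrderDual.toDual γ) = ∑ᶠ w, (C u w).coeff (OrderDual.toDual γ)

/-- `g` is the series obtained by applying `w` to the series `f` and expanding the result again
in negative powers of the coroots.  Applying `w` termwise to `f` may leave the ring of series,
so a common denominator `d` is cleared first: `w (d f) = (w d) g`, where `w` on the left moves
the coefficient of `e^γ` to `e^{wγ}`.  For the expansion `f` of a rational function `r` this gives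
the expansion of `w r`. -/
def IsTransform (w : D.weylGroup) (f g : CorootSeries I) : Prop :=
  ∃ d : CorootAlg I, d ≠ 0 ∧ ∀ γ : I → ℤ,
    (toSeries I (w • d) * g).coeff (OrderDual.toDual (w.1 γ)) =
      (toSeries I d * f).coeff (OrderDual.toDual γ)

/-- For `t = ∑_y t_y [y]` in `R[W]` and a formal sum `F = ∑_u F_u [u]`, the product
`t F = ∑_u (∑_y t_y · y(F_{y⁻¹u})) [u]` is well defined and equal to `∑_u G_u [u]`. -/
def IsLeftProd (t : D.RW) (F G : D.weylGroup → CorootSeries I) : Prop :=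
  ∃ (E : D.weylGroup → CorootSeries I) (H : D.weylGroup → D.weylGroup → CorootSeries I),
    (∀ y ∈ t.support, IsExpansion (t.coeff y) (E y)) ∧
    (∀ y ∈ t.support, ∀ u, D.IsTransform y (F (y⁻¹ * u)) (H y u)) ∧
    ∀ u, G u = ∑ y ∈ t.support, E y * H y u

/-- For `t = ∑_y t_y [y]` in `R[W]` and a formal sum `F = ∑_u F_u [u]`, the product
`F t = ∑_u (∑_y F_{uy⁻¹} · (uy⁻¹)(t_y)) [u]` is well defined and equal to `∑_u G_u [u]`. -/
def IsRightProd (F : D.weylGroup → CorootSeries I) (t : D.RW)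
    (G : D.weylGroup → CorootSeries I) : Prop :=
  ∃ E : D.weylGroup → D.weylGroup → CorootSeries I,
    (∀ y ∈ t.support, ∀ u, IsExpansion ((u * y⁻¹) • t.coeff y) (E y u)) ∧
    ∀ u, G u = ∑ y ∈ t.support, F (u * y⁻¹) * E y u

/-- The real coroots: the `W`-conjugates of the simple coroots. -/
def IsRealCoroot (γ : I → ℤ) : Prop :=
  ∃ (w : D.weylGroup) (i : I), γ = w.1 (D.simpleCoroot i)

/-- The positive coroots, real and imaginary; the imaginary ones are the positive multiples
of `c`. -/
def IsPosCoroot (γ : I → ℤ) : Prop :=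
  (D.IsRealCoroot γ ∧ 0 ≤ γ) ∨ ∃ n : ℕ, 0 < n ∧ γ = n • D.c

open Classical in
/-- The multiplicity of a coroot: `1` if it is real and `ℓ = |I| - 1` if it is imaginary. -/
def mult (γ : I → ℤ) : ℕ := if D.IsRealCoroot γ then 1 else Fintype.card I - 1

open Classical in
/-- The product of `(1 - v⁻¹ e^{-γ})^{m(γ)}` over the positive coroots `γ` in the finite set
`{0 ≤ γ ≤ β}`. -/
def partialProd (β : I → ℤ) : CorootSeries I :=
  ∏ γ ∈ (Finset.Icc 0 β).filter (fun γ => D.IsPosCoroot γ),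
    (1 - vInvS I * expS (-γ)) ^ D.mult γ

theorem partialProd_coeff_eq_zero {γ : I → ℤ} (h : ¬ γ ≤ 0) :
    (D.partialProd (-γ)).coeff (OrderDual.toDual γ) = 0 := by
  have h1 : Finset.Icc 0 (-γ) = ∅ := by
    rw [Finset.Icc_eq_empty_iff]
    simpa using h
  have h2 : OrderDual.toDual γ ≠ 0 := by
    intro h'
    exact h (le_of_eq h')
  simp [partialProd, h1, HahnSeries.coeff_one, h2]

/-- The infinite product `𝔇_v = ∏_γ (1 - v⁻¹ e^{-γ})^{m(γ)}` over the positive coroots.  The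
coefficient of `e^γ` only involves the factors belonging to positive coroots `≤ -γ`. -/
def Dv : CorootSeries I where
  coeff x := (D.partialProd (-(OrderDual.ofDual x))).coeff x
  isPWO_support' := isPWO_Iic_zero.mono (fun x hx => by
    by_contra h
    exact hx (D.partialProd_coeff_eq_zero (γ := OrderDual.ofDual x) h))

end AffineDatum

end

/-!
Choosing `[w_a]` or `[1]` in every factor `𝐜(a^∨) [w_a] + 𝐛(a^∨) [1]` of `T_w` amounts to folding a
gallery of type `w` at some of its walls. The exponents of the term of a gallery from `1` to `u` are
bounded by `-σ`, where `σ` is the sum of the coroots of the walls at which it is folded back to the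
side of `1`. Undoing the folds one at a time bounds the height of `ρ - wρ` in terms of `σ` and `u`,
so a given `e^γ` occurs in `C_u(w)` for finitely many `w` only.

The quadratic relation gives `T_a (T_w + T_{w_a w}) = v⁻¹ (T_w + T_{w_a w})` and its analogue on the
right, and hence the eigenvector equations for `𝒫`. The coefficients of `T_w` have at most simple
poles along `e^{a^∨} = 1`, with opposite residues at `u` and `w_a u`. Therefore a denominator
independent of `w` allows `w_a` to be applied termwise to `𝒫`, and `T_a 𝒫 = v⁻¹ 𝒫` turns into the
formula for `[w_a] 𝒫`. Finally, `w_a` permutes the positive coroots other than `a^∨`, so it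
multiplies `𝔇_v` by the same factor as `𝒫`.
-/

section SymmetricMatrices

open Matrix

variable {n R : Type*} [Fintype n]

theorem two_mul_dotProduct_mulVec_mul_self [CommRing R] {A : Matrix n n R} (hA : A.IsSymm)
    (c y : n → R) :
    2 * ((c * y) ⬝ᵥ A *ᵥ (c * y)) =
      2 * ∑ i, c i * (A *ᵥ c) i * y i ^ 2 - ∑ i, ∑ j, A i j * c i * c j * (y i - y j) ^ 2 := by
  have form_eq : (c * y) ⬝ᵥ A *ᵥ (c * y) = ∑ i, ∑ j, A i j * c i * c j * (y i * y j) := by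
    simp only [dotProduct, mulVec, Pi.mul_apply, Finset.mul_sum]
    exact Finset.sum_congr rfl fun i _ => Finset.sum_congr rfl fun j _ => by ring
  have left_eq : ∑ i, c i * (A *ᵥ c) i * y i ^ 2 = ∑ i, ∑ j, A i j * c i * c j * y i ^ 2 := by
    simp only [dotProduct, mulVec, Finset.mul_sum, Finset.sum_mul]
    exact Finset.sum_congr rfl fun i _ => Finset.sum_congr rfl fun j _ => by ring
  have right_eq :
      ∑ i, ∑ j, A i j * c i * c j * y j ^ 2 = ∑ i, ∑ j, A i j * c i * c j * y i ^ 2 := by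
    rw [Finset.sum_comm]
    refine Finset.sum_congr rfl fun i _ => Finset.sum_congr rfl fun j _ => ?_
    rw [hA.apply i j]
    ring
  have sq_eq (i j : n) : A i j * c i * c j * (y i - y j) ^ 2 =
      A i j * c i * c j * y i ^ 2 + A i j * c i * c j * y j ^ 2 -
        2 * (A i j * c i * c j * (y i * y j)) := by ring
  simp only [sq_eq, Finset.sum_sub_distrib, Finset.sum_add_distrib, ← Finset.mul_sum]
  rw [form_eq, left_eq, right_eq]
  ring

theorem dotProduct_mulVec_self_nonneg [Field R] [LinearOrder R] [IsStrictOrderedRing R]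
    {A : Matrix n n R} (hA : A.IsSymm) (hoff : ∀ i j, i ≠ j → A i j ≤ 0) {c : n → R}
    (hc : ∀ i, 0 < c i) (hAc : 0 ≤ A *ᵥ c) (x : n → R) : 0 ≤ x ⬝ᵥ A *ᵥ x := by
  have hx : c * (x / c) = x := funext fun i => mul_div_cancel₀ _ (hc i).ne'
  have hdiag : 0 ≤ ∑ i, c i * (A *ᵥ c) i * (x / c) i ^ 2 :=
    Finset.sum_nonneg fun i _ => mul_nonneg (mul_nonneg (hc i).le (hAc i)) (sq_nonneg _)
  have hoffDiag : ∑ i, ∑ j, A i j * c i * c j * ((x / c) i - (x / c) j) ^ 2 ≤ 0 := by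
    refine Finset.sum_nonpos fun i _ => Finset.sum_nonpos fun j _ => ?_
    rcases eq_or_ne i j with rfl | hij
    · simp
    · exact mul_nonpos_of_nonpos_of_nonneg (mul_nonpos_of_nonpos_of_nonneg
        (mul_nonpos_of_nonpos_of_nonneg (hoff i j hij) (hc i).le) (hc j).le) (sq_nonneg _)
  have key := two_mul_dotProduct_mulVec_mul_self hA c (x / c)
  rw [hx] at key
  linarith

end SymmetricMatrices

theorem even_bilin_self_of_mem_span {R M : Type*} [CommRing R] [AddCommGroup M] [Module R M]
    {B : LinearMap.BilinForm R M} (hB : B.IsSymm) {s : Set M} (hs : ∀ x ∈ s, Even (B x x)) {x : M}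
    (hx : x ∈ Submodule.span R s) : Even (B x x) := by
  induction hx using Submodule.span_induction with
  | mem x hx => exact hs x hx
  | zero => simp
  | add x y _ _ ihx ihy =>
    have hxy : B (x + y) (x + y) = B x x + B y y + (B x y + B x y) := by
      rw [map_add, map_add, LinearMap.add_apply, LinearMap.add_apply, hB.eq y x]
      ring
    exact hxy ▸ (ihx.add ihy).add (Even.add_self _)
  | smul r x _ ih => simpa using (ih.mul_left r).mul_left r

section Height

variable {I : Type*} [Fintype I]

/-- The height of a vector of the coroot lattice: the sum of its coordinates with respect to the
simple coroots. -/
def height : (I → ℤ) →ₗ[ℤ] ℤ := ∑ i, LinearMap.proj i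

theorem height_apply (x : I → ℤ) : height x = ∑ i, x i := by
  simp [height]

theorem height_mono {x y : I → ℤ} (h : x ≤ y) : height x ≤ height y := by
  simpa only [height_apply] using Finset.sum_le_sum fun i _ => h i

theorem height_nonneg {x : I → ℤ} (h : 0 ≤ x) : 0 ≤ height x := by
  simpa only [map_zero] using height_mono h

theorem height_pos {x : I → ℤ} (h : 0 ≤ x) (h' : x ≠ 0) : 0 < height x := by
  obtain ⟨i, hi⟩ := Function.ne_iff.mp h'
  rw [height_apply]
  exact Finset.sum_pos' (fun i _ => h i) ⟨i, Finset.mem_univ i, lt_of_le_of_ne (h i) (Ne.symm hi)⟩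

end Height

namespace AffineDatum

variable {I : Type*} [Fintype I] [DecidableEq I] (D : AffineDatum I)

theorem simpleCoroot_nonneg (i : I) : 0 ≤ D.simpleCoroot i :=
  Pi.single_nonneg.mpr zero_le_one

theorem not_simpleCoroot_nonpos (i : I) : ¬ D.simpleCoroot i ≤ 0 := fun h =>
  absurd (h i) (by simp [simpleCoroot])

theorem height_simpleCoroot (i : I) : height (D.simpleCoroot i) = 1 := by
  simp [height_apply, simpleCoroot]

/-! ### The invariant form -/

/-- The symmetric bilinear form on the coroot lattice given by the Cartan matrix. -/
def form : LinearMap.BilinForm ℤ (I → ℤ) := Matrix.toBilin' D.A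

theorem form_def (x y : I → ℤ) : D.form x y = x ⬝ᵥ D.A.mulVec y :=
  Matrix.toBilin'_apply' _ _ _

theorem form_isSymm : D.form.IsSymm := Matrix.isSymm_toBilin'_iff_isSymm.mpr D.symm

theorem form_comm (x y : I → ℤ) : D.form x y = D.form y x := D.form_isSymm.eq x y

theorem form_simpleCoroot_left (i : I) (x : I → ℤ) :
    D.form (D.simpleCoroot i) x = D.simpleRoot i x := by
  rw [form_def]
  simp [simpleCoroot, simpleRoot]

theorem form_simpleCoroot (i j : I) : D.form (D.simpleCoroot i) (D.simpleCoroot j) = D.A i j :=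
  Matrix.toBilin'_single _ _ _

theorem form_simpleCoroot_self (i : I) : D.form (D.simpleCoroot i) (D.simpleCoroot i) = 2 := by
  rw [form_simpleCoroot, D.diag]

theorem form_c_right (x : I → ℤ) : D.form x D.c = 0 := by
  rw [form_def, D.A_mulVec_c, dotProduct_zero]

theorem form_self_nonneg (x : I → ℤ) : 0 ≤ D.form x x := by
  have hAc : (D.A.map (Int.cast : ℤ → ℚ)).mulVec (fun i => (D.c i : ℚ)) = 0 := by
    funext i
    have h := congrFun D.A_mulVec_c i
    simp only [Matrix.mulVec, dotProduct, Pi.zero_apply, Matrix.map_apply] at h ⊢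
    exact_mod_cast h
  have hcast : (D.form x x : ℚ) =
      (fun i => (x i : ℚ)) ⬝ᵥ (D.A.map (Int.cast : ℤ → ℚ)).mulVec (fun i => (x i : ℚ)) := by
    simp only [form_def, dotProduct, Matrix.mulVec, Matrix.map_apply]
    push_cast
    rfl
  have hnonneg := dotProduct_mulVec_self_nonneg (D.symm.map (Int.cast : ℤ → ℚ))
    (fun i j hij => Int.cast_nonpos.mpr (D.offDiag i j hij))
    (fun i => Int.cast_pos.mpr (D.c_pos i)) hAc.ge (fun i => (x i : ℚ))
  exact_mod_cast hcast ▸ hnonneg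

theorem form_sq_le (x y : I → ℤ) : D.form x y ^ 2 ≤ D.form x x * D.form y y :=
  LinearMap.BilinForm.apply_sq_le_of_symm D.form D.form_self_nonneg ⟨D.form_comm⟩ x y

theorem exists_eq_smul_c_of_form_self_eq_zero {x : I → ℤ} (h : D.form x x = 0) :
    ∃ n : ℤ, x = n • D.c := by
  refine D.ker_eq x (funext fun i => ?_)
  have hle := D.form_sq_le (D.simpleCoroot i) x
  rw [h, mul_zero, form_simpleCoroot_left] at hle
  exact pow_eq_zero_iff two_ne_zero |>.mp (le_antisymm hle (sq_nonneg _))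

theorem even_form_self (x : I → ℤ) : Even (D.form x x) := by
  refine even_bilin_self_of_mem_span D.form_isSymm (s := Set.range D.simpleCoroot) ?_ ?_
  · rintro _ ⟨i, rfl⟩
    rw [form_simpleCoroot_self]
    exact even_two
  · have hbasis : D.simpleCoroot = Pi.basisFun ℤ I := funext fun i => by
      rw [simpleCoroot, Pi.basisFun_apply]
    rw [hbasis, (Pi.basisFun ℤ I).span_eq]
    trivial

theorem two_le_form_self {x : I → ℤ} (hx : x ≠ 0) {i : I} (hi : x i = 0) : 2 ≤ D.form x x := by
  have hne : D.form x x ≠ 0 := by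
    intro h
    obtain ⟨n, rfl⟩ := D.exists_eq_smul_c_of_form_self_eq_zero h
    have hn : n = 0 := by simpa [(D.c_pos i).ne'] using hi
    exact hx (by rw [hn, zero_smul])
  obtain ⟨k, hk⟩ := D.even_form_self x
  have hnonneg := D.form_self_nonneg x
  omega

theorem form_posPart_negPart_nonpos (x : I → ℤ) : D.form x⁺ x⁻ ≤ 0 := by
  rw [form, Matrix.toBilin'_apply]
  refine Finset.sum_nonpos fun i _ => Finset.sum_nonpos fun j _ => ?_
  rcases eq_or_ne i j with rfl | hij
  · have hdisj : x⁺ i = 0 ∨ x⁻ i = 0 := by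
      rw [Pi.posPart_apply, Pi.negPart_apply, posPart_eq_zero, negPart_eq_zero]
      exact le_total _ _
    rcases hdisj with h | h <;> simp [h]
  · exact mul_nonpos_of_nonpos_of_nonneg
      (mul_nonpos_of_nonneg_of_nonpos (posPart_nonneg x i) (D.offDiag i j hij))
      (negPart_nonneg x j)

theorem four_le_form_self {x : I → ℤ} (h : ¬ 0 ≤ x) (h' : ¬ x ≤ 0) : 4 ≤ D.form x x := by
  obtain ⟨i, hi⟩ : ∃ i, x i < 0 := by simpa [Pi.le_def] using h
  obtain ⟨j, hj⟩ : ∃ j, 0 < x j := by simpa [Pi.le_def] using h'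
  have hpos : 2 ≤ D.form x⁺ x⁺ :=
    D.two_le_form_self (mt posPart_eq_zero.mp h')
      (i := i) (by rw [Pi.posPart_apply, posPart_eq_zero]; exact hi.le)
  have hneg : 2 ≤ D.form x⁻ x⁻ :=
    D.two_le_form_self (mt negPart_eq_zero.mp h)
      (i := j) (by rw [Pi.negPart_apply, negPart_eq_zero]; exact hj.le)
  have hexpand : D.form x x = D.form x⁺ x⁺ + D.form x⁻ x⁻ - 2 * D.form x⁺ x⁻ := by
    conv_lhs => rw [← posPart_sub_negPart x]
    simp only [map_sub, LinearMap.sub_apply]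
    rw [D.form_comm x⁻ x⁺]
    ring
  have hmixed := D.form_posPart_negPart_nonpos x
  omega

/-! ### The Weyl group -/

theorem refl_apply (i : I) (x : I → ℤ) :
    (D.refl i).1 x = x - D.form (D.simpleCoroot i) x • D.simpleCoroot i := by
  rw [form_simpleCoroot_left]
  exact Module.reflection_apply x (D.simpleRoot_simpleCoroot i)

@[simp]
theorem mul_apply (u w : D.weylGroup) (x : I → ℤ) : (u * w).1 x = u.1 (w.1 x) := rfl

@[simp]
theorem one_apply (x : I → ℤ) : (1 : D.weylGroup).1 x = x := rfl

@[simp]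
theorem inv_apply_apply (w : D.weylGroup) (x : I → ℤ) : w⁻¹.1 (w.1 x) = x := by
  rw [← mul_apply, inv_mul_cancel, one_apply]

@[simp]
theorem apply_inv_apply (w : D.weylGroup) (x : I → ℤ) : w.1 (w⁻¹.1 x) = x := by
  rw [← mul_apply, mul_inv_cancel, one_apply]

@[simp]
theorem refl_simpleCoroot (i : I) : (D.refl i).1 (D.simpleCoroot i) = -D.simpleCoroot i := by
  rw [refl_apply, form_simpleCoroot_self]
  module

@[simp]
theorem refl_mul_self (i : I) : D.refl i * D.refl i = 1 :=
  Subtype.ext (LinearEquiv.ext (Module.involutive_reflection (D.simpleRoot_simpleCoroot i)))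

@[simp]
theorem refl_refl_apply (i : I) (x : I → ℤ) : (D.refl i).1 ((D.refl i).1 x) = x := by
  rw [← mul_apply, refl_mul_self, one_apply]

@[simp]
theorem refl_inv (i : I) : (D.refl i)⁻¹ = D.refl i :=
  inv_eq_of_mul_eq_one_right (D.refl_mul_self i)

@[simp]
theorem mul_refl_mul_refl (w : D.weylGroup) (i : I) : w * D.refl i * D.refl i = w := by
  rw [mul_assoc, refl_mul_self, mul_one]

@[simp]
theorem refl_mul_refl_mul (w : D.weylGroup) (i : I) : D.refl i * (D.refl i * w) = w := by
  rw [← mul_assoc, refl_mul_self, one_mul]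

@[simp]
theorem wordProd_nil : D.wordProd [] = 1 := rfl

@[simp]
theorem wordProd_cons (i : I) (l : List I) : D.wordProd (i :: l) = D.refl i * D.wordProd l := by
  simp [wordProd]

@[simp]
theorem wordProd_append (l l' : List I) :
    D.wordProd (l ++ l') = D.wordProd l * D.wordProd l' := by
  simp [wordProd]

@[simp]
theorem wordProd_reverse (l : List I) : D.wordProd l.reverse = (D.wordProd l)⁻¹ := by
  induction l with
  | nil => simp
  | cons i l ih => simp [ih]

@[elab_as_elim]
theorem weyl_induction_right {p : D.weylGroup → Prop} (one : p 1)
    (mul_refl : ∀ w i, p w → p (w * D.refl i)) (w : D.weylGroup) : p w := by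
  obtain ⟨w, hw⟩ := w
  induction hw using Subgroup.closure_induction_right with
  | one => exact one
  | mul_right w hw _ hy ih =>
    obtain ⟨i, rfl⟩ := hy
    exact mul_refl ⟨w, hw⟩ i ih
  | mul_inv_cancel w hw _ hy ih =>
    obtain ⟨i, rfl⟩ := hy
    have hstep := mul_refl ⟨w, hw⟩ i ih
    rw [← refl_inv] at hstep
    exact hstep

theorem exists_wordProd_eq (w : D.weylGroup) : ∃ l, D.wordProd l = w := by
  induction w using D.weyl_induction_right with
  | one => exact ⟨[], rfl⟩
  | mul_refl w i ih =>
    obtain ⟨l, rfl⟩ := ih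
    exact ⟨l ++ [i], by simp⟩

theorem form_refl_refl (i : I) (x y : I → ℤ) :
    D.form ((D.refl i).1 x) ((D.refl i).1 y) = D.form x y := by
  simp only [refl_apply, map_sub, map_smul, LinearMap.sub_apply, LinearMap.smul_apply, smul_eq_mul,
    form_simpleCoroot_self]
  rw [D.form_comm x (D.simpleCoroot i)]
  ring

theorem form_apply_apply (w : D.weylGroup) (x y : I → ℤ) :
    D.form (w.1 x) (w.1 y) = D.form x y := by
  induction w using D.weyl_induction_right generalizing x y with
  | one => rfl
  | mul_refl w i ih => rw [mul_apply, mul_apply, ih, form_refl_refl]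

theorem form_apply_right (w : D.weylGroup) (x y : I → ℤ) :
    D.form x (w.1 y) = D.form (w⁻¹.1 x) y := by
  rw [← D.form_apply_apply w (w⁻¹.1 x), apply_inv_apply]

theorem apply_c (w : D.weylGroup) : w.1 D.c = D.c := by
  induction w using D.weyl_induction_right with
  | one => rfl
  | mul_refl w i ih => rw [mul_apply, refl_apply, form_c_right, zero_smul, sub_zero, ih]

theorem mul_refl_eq_refl_mul {u : D.weylGroup} {i j : I}
    (h : u.1 (D.simpleCoroot i) = D.simpleCoroot j ∨ u.1 (D.simpleCoroot i) = -D.simpleCoroot j) :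
    u * D.refl i = D.refl j * u := by
  refine Subtype.ext (LinearEquiv.ext fun x => ?_)
  rw [mul_apply, mul_apply, D.refl_apply i, D.refl_apply j, map_sub, map_smul,
    ← D.form_apply_apply u (D.simpleCoroot i)]
  rcases h with h | h <;> simp [h]

/-! ### Real coroots -/

theorem isRealCoroot_simpleCoroot (i : I) : D.IsRealCoroot (D.simpleCoroot i) := ⟨1, i, rfl⟩

namespace IsRealCoroot

variable {D} {γ : I → ℤ}

theorem form_self (h : D.IsRealCoroot γ) : D.form γ γ = 2 := by
  obtain ⟨w, i, rfl⟩ := h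
  rw [form_apply_apply, form_simpleCoroot_self]

theorem apply (h : D.IsRealCoroot γ) (w : D.weylGroup) : D.IsRealCoroot (w.1 γ) := by
  obtain ⟨u, i, rfl⟩ := h
  exact ⟨w * u, i, rfl⟩

theorem neg (h : D.IsRealCoroot γ) : D.IsRealCoroot (-γ) := by
  obtain ⟨u, i, rfl⟩ := h
  exact ⟨u * D.refl i, i, by rw [mul_apply, refl_simpleCoroot, map_neg]⟩

theorem ne_zero (h : D.IsRealCoroot γ) : γ ≠ 0 := by
  rintro rfl
  simpa using h.form_self

theorem nonneg_or_nonpos (h : D.IsRealCoroot γ) : 0 ≤ γ ∨ γ ≤ 0 := by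
  by_contra! hcon
  have hfour := D.four_le_form_self hcon.1 hcon.2
  rw [h.form_self] at hfour
  norm_num at hfour

theorem not_nonneg_iff (h : D.IsRealCoroot γ) : ¬ 0 ≤ γ ↔ γ ≤ 0 :=
  ⟨h.nonneg_or_nonpos.resolve_left, fun hneg hpos => h.ne_zero (le_antisymm hneg hpos)⟩

theorem one_le_height (h : D.IsRealCoroot γ) (h' : 0 ≤ γ) : 1 ≤ height γ :=
  height_pos h' h.ne_zero

theorem eq_simpleCoroot (h : D.IsRealCoroot γ) (h0 : 0 ≤ γ) {i : I} (hi : ∀ j ≠ i, γ j = 0) :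
    γ = D.simpleCoroot i := by
  have hγ : γ = γ i • D.simpleCoroot i := by
    funext j
    rcases eq_or_ne j i with rfl | hj
    · simp [simpleCoroot]
    · simp [simpleCoroot, hj, hi j hj]
  have hsq : γ i * (γ i * 2) = 2 := by
    have hform := h.form_self
    rw [hγ] at hform
    simpa only [map_smul, LinearMap.smul_apply, smul_eq_mul, form_simpleCoroot_self] using hform
  have hone : γ i = 1 := by
    have hi0 : 0 ≤ γ i := h0 i
    nlinarith
  rw [hγ, hone, one_smul]

theorem refl_nonneg (h : D.IsRealCoroot γ) (h0 : 0 ≤ γ) {i : I} (hi : γ ≠ D.simpleCoroot i) :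
    0 ≤ (D.refl i).1 γ := by
  by_contra hcon
  rw [(h.apply _).not_nonneg_iff] at hcon
  refine hi (h.eq_simpleCoroot h0 fun j hj => le_antisymm ?_ (h0 j))
  have hcoord : (D.refl i).1 γ j = γ j := by simp [refl_apply, simpleCoroot, hj]
  exact hcoord ▸ hcon j

end IsRealCoroot

theorem isRealCoroot_apply_simpleCoroot (w : D.weylGroup) (i : I) :
    D.IsRealCoroot (w.1 (D.simpleCoroot i)) := ⟨w, i, rfl⟩

theorem apply_simpleCoroot_ne_zero (w : D.weylGroup) (i : I) : w.1 (D.simpleCoroot i) ≠ 0 :=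
  (D.isRealCoroot_apply_simpleCoroot w i).ne_zero

/-! ### Reduced words -/

theorem exists_wordProd_eq_mul_refl {l : List I} {i : I}
    (h : (D.wordProd l).1 (D.simpleCoroot i) ≤ 0) :
    ∃ l' : List I, l'.length + 1 = l.length ∧ D.wordProd l' = D.wordProd l * D.refl i := by
  induction l with
  | nil => exact absurd h (D.not_simpleCoroot_nonpos i)
  | cons j l ih =>
    have hr := D.isRealCoroot_apply_simpleCoroot (D.wordProd l) i
    rcases hr.nonneg_or_nonpos with hpos | hneg
    · have heq : (D.wordProd l).1 (D.simpleCoroot i) = D.simpleCoroot j := by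
        by_contra hne
        rw [wordProd_cons, mul_apply] at h
        exact (hr.apply (D.refl j)).ne_zero (le_antisymm h (hr.refl_nonneg hpos hne))
      refine ⟨l, rfl, ?_⟩
      rw [wordProd_cons, mul_assoc, D.mul_refl_eq_refl_mul (Or.inl heq), refl_mul_refl_mul]
    · obtain ⟨l', hlen, hl'⟩ := ih hneg
      exact ⟨j :: l', by simp [hlen], by rw [wordProd_cons, wordProd_cons, hl', mul_assoc]⟩

theorem exists_isReduced_wordProd_eq (w : D.weylGroup) :
    ∃ l, D.IsReduced l ∧ D.wordProd l = w := by
  let words := {l : List I | D.wordProd l = w}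
  have hne : words.Nonempty := D.exists_wordProd_eq w
  refine ⟨Function.argminOn List.length words hne, fun l' hl' => ?_,
    Function.argminOn_mem List.length words hne⟩
  have hmem : D.wordProd l' = w := hl'.trans (Function.argminOn_mem List.length words hne)
  exact Function.argminOn_le List.length words hmem

namespace IsReduced

variable {D} {l l' : List I} {i : I}

theorem reverse (h : D.IsReduced l) : D.IsReduced l.reverse := fun l' hl' => by
  simpa using h l'.reverse (by rw [wordProd_reverse, hl', wordProd_reverse, inv_inv])

theorem left (h : D.IsReduced (l ++ l')) : D.IsReduced l := fun m hm => by
  simpa using h (m ++ l') (by rw [wordProd_append, wordProd_append, hm])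

theorem right (h : D.IsReduced (l ++ l')) : D.IsReduced l' := fun m hm => by
  simpa using h (l ++ m) (by rw [wordProd_append, wordProd_append, hm])

theorem length_eq (h : D.IsReduced l) (h' : D.IsReduced l') (hw : D.wordProd l = D.wordProd l') :
    l.length = l'.length :=
  le_antisymm (h l' hw.symm) (h' l hw)

theorem apply_nonneg (h : D.IsReduced (l ++ [i])) : 0 ≤ (D.wordProd l).1 (D.simpleCoroot i) := by
  by_contra hcon
  rw [(D.isRealCoroot_apply_simpleCoroot _ _).not_nonneg_iff] at hcon
  obtain ⟨l', hlen, hl'⟩ := D.exists_wordProd_eq_mul_refl hcon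
  have hle := h l' (by simp [hl'])
  rw [List.length_append, List.length_singleton] at hle
  omega

theorem append (h : D.IsReduced l) (hi : 0 ≤ (D.wordProd l).1 (D.simpleCoroot i)) :
    D.IsReduced (l ++ [i]) := by
  intro l' hl'
  obtain ⟨m, hlen, hm⟩ := D.exists_wordProd_eq_mul_refl (l := l') (i := i) (by simpa [hl'] using hi)
  have hle := h m (by simp [hm, hl'])
  rw [List.length_append, List.length_singleton]
  omega

theorem inv_apply_nonneg (h : D.IsReduced (i :: l)) :
    0 ≤ (D.wordProd l)⁻¹.1 (D.simpleCoroot i) := by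
  have hrev := h.reverse
  rw [List.reverse_cons] at hrev
  simpa using hrev.apply_nonneg

theorem cons (h : D.IsReduced l) (hi : 0 ≤ (D.wordProd l)⁻¹.1 (D.simpleCoroot i)) :
    D.IsReduced (i :: l) := by
  simpa using (h.reverse.append (i := i) (by simpa using hi)).reverse

end IsReduced

theorem exists_isReduced_cons {w : D.weylGroup} {i : I} (h : w⁻¹.1 (D.simpleCoroot i) ≤ 0) :
    ∃ l, D.IsReduced (i :: l) ∧ D.wordProd l = D.refl i * w := by
  obtain ⟨l, hl, hw⟩ := D.exists_isReduced_wordProd_eq (D.refl i * w)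
  exact ⟨l, hl.cons (by simpa [hw] using h), hw⟩

end AffineDatum

noncomputable section

namespace AffineDatum

variable {I : Type*} [Fintype I] [DecidableEq I] (D : AffineDatum I)

/-! ### Inversions and depth -/

/-- The (left) inversion set of `w`: the positive real coroots made negative by `w⁻¹`. -/
def inversions (w : D.weylGroup) : Set (I → ℤ) :=
  {β | D.IsRealCoroot β ∧ 0 ≤ β ∧ w⁻¹.1 β ≤ 0}

theorem inversions_one : D.inversions 1 = ∅ :=
  Set.eq_empty_of_forall_notMem fun _ ⟨h, h0, h1⟩ => h.ne_zero (le_antisymm (by simpa using h1) h0)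

theorem inversions_mul_refl {w : D.weylGroup} {i : I} (h : 0 ≤ w.1 (D.simpleCoroot i)) :
    D.inversions (w * D.refl i) = insert (w.1 (D.simpleCoroot i)) (D.inversions w) := by
  ext β
  simp only [inversions, mul_inv_rev, refl_inv, mul_apply, Set.mem_ofPred_eq, Set.mem_insert_iff]
  constructor
  · rintro ⟨hβ, hβ0, hneg⟩
    have hreal := hβ.apply w⁻¹
    rcases hreal.nonneg_or_nonpos with h0 | h0
    · left
      by_contra hne
      have hpos := hreal.refl_nonneg h0 (i := i) fun h => hne (by rw [← h, apply_inv_apply])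
      exact (hreal.apply (D.refl i)).ne_zero (le_antisymm hneg hpos)
    · exact Or.inr ⟨hβ, hβ0, h0⟩
  · rintro (rfl | ⟨hβ, hβ0, hneg⟩)
    · exact ⟨D.isRealCoroot_apply_simpleCoroot w i, h, by simpa using D.simpleCoroot_nonneg i⟩
    · have hne : -(w⁻¹.1 β) ≠ D.simpleCoroot i := fun heq => by
        have hβ_eq : β = -w.1 (D.simpleCoroot i) := by
          rw [← heq, map_neg, apply_inv_apply, neg_neg]
        exact hβ.ne_zero (le_antisymm (hβ_eq ▸ neg_nonpos.mpr h) hβ0)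
      have hpos := (hβ.apply w⁻¹).neg.refl_nonneg (neg_nonneg.mpr hneg) hne
      rw [map_neg] at hpos
      exact ⟨hβ, hβ0, neg_nonneg.mp hpos⟩

theorem apply_simpleCoroot_notMem_inversions (w : D.weylGroup) (i : I) :
    w.1 (D.simpleCoroot i) ∉ D.inversions w := fun h =>
  D.not_simpleCoroot_nonpos i (by simpa using h.2.2)

theorem inversions_finite (w : D.weylGroup) : (D.inversions w).Finite := by
  induction w using D.weyl_induction_right with
  | one => exact D.inversions_one ▸ Set.finite_empty
  | mul_refl w i ih =>
    rcases (D.isRealCoroot_apply_simpleCoroot w i).nonneg_or_nonpos with h | h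
    · exact D.inversions_mul_refl h ▸ ih.insert _
    · have hinsert := D.inversions_mul_refl (w := w * D.refl i) (i := i) (by simpa using h)
      rw [mul_refl_mul_refl] at hinsert
      exact ih.subset (hinsert ▸ Set.subset_insert _ _)

/-- The sum of the inversions of `w`; it plays the role of `ρ - wρ`, in which `ρ` itself does not
belong to the coroot lattice. -/
def invSum (w : D.weylGroup) : I → ℤ := ∑ᶠ β ∈ D.inversions w, β

theorem invSum_one : D.invSum 1 = 0 := by
  simp [invSum, inversions_one]

theorem invSum_nonneg (w : D.weylGroup) : 0 ≤ D.invSum w :=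
  finsum_mem_induction (p := fun x => 0 ≤ x) le_rfl (fun _ _ => add_nonneg) fun _ hβ => hβ.2.1

theorem invSum_mul_refl (w : D.weylGroup) (i : I) :
    D.invSum (w * D.refl i) = D.invSum w + w.1 (D.simpleCoroot i) := by
  have of_nonneg (w : D.weylGroup) (h : 0 ≤ w.1 (D.simpleCoroot i)) :
      D.invSum (w * D.refl i) = D.invSum w + w.1 (D.simpleCoroot i) := by
    rw [invSum, D.inversions_mul_refl h, finsum_mem_insert _
      (D.apply_simpleCoroot_notMem_inversions w i) (D.inversions_finite w), add_comm]
    rfl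
  rcases (D.isRealCoroot_apply_simpleCoroot w i).nonneg_or_nonpos with h | h
  · exact of_nonneg w h
  · have hback := of_nonneg (w * D.refl i) (by simpa using h)
    rw [mul_refl_mul_refl, mul_apply, refl_simpleCoroot, map_neg] at hback
    rw [hback]
    abel

theorem invSum_mul (u w : D.weylGroup) : D.invSum (u * w) = D.invSum u + u.1 (D.invSum w) := by
  induction w using D.weyl_induction_right with
  | one => simp [invSum_one]
  | mul_refl w i ih =>
    rw [← mul_assoc, invSum_mul_refl, ih, invSum_mul_refl, map_add, mul_apply, add_assoc]

theorem invSum_refl (i : I) : D.invSum (D.refl i) = D.simpleCoroot i := by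
  simpa [invSum_one] using D.invSum_mul_refl 1 i

theorem apply_invSum_inv (w : D.weylGroup) : w.1 (D.invSum w⁻¹) = -D.invSum w := by
  rw [eq_neg_iff_add_eq_zero, add_comm, ← invSum_mul, mul_inv_cancel, invSum_one]

theorem form_invSum (w : D.weylGroup) (x : I → ℤ) :
    D.form x (D.invSum w) = height x - height (w⁻¹.1 x) := by
  induction w using D.weyl_induction_right with
  | one => simp [invSum_one]
  | mul_refl w i ih =>
    rw [invSum_mul_refl, map_add, ih, mul_inv_rev, refl_inv, mul_apply, refl_apply, map_sub,
      map_smul, D.height_simpleCoroot, form_apply_right, D.form_comm (D.simpleCoroot i),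
      smul_eq_mul]
    ring

/-- The height of `ρ - wρ`. -/
def depth (w : D.weylGroup) : ℤ := height (D.invSum w)

theorem depth_one : D.depth 1 = 0 := by
  rw [depth, invSum_one, map_zero]

theorem depth_nonneg (w : D.weylGroup) : 0 ≤ D.depth w := height_nonneg (D.invSum_nonneg w)

theorem depth_mul_refl_mul (u w : D.weylGroup) (i : I) :
    D.depth (u * (D.refl i * w)) = D.depth (u * w) +
      height (u.1 (D.simpleCoroot i)) * height (w⁻¹.1 (D.simpleCoroot i)) := by
  have hinvSum : D.invSum (u * (D.refl i * w)) = D.invSum (u * w) +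
      height (w⁻¹.1 (D.simpleCoroot i)) • u.1 (D.simpleCoroot i) := by
    rw [invSum_mul, invSum_mul, invSum_refl, invSum_mul, refl_apply, form_invSum,
      D.height_simpleCoroot, map_add, map_sub, map_smul]
    module
  rw [depth, hinvSum, map_add, map_smul, smul_eq_mul, depth, mul_comm (height _)]

theorem depth_mul_refl (u : D.weylGroup) (i : I) :
    D.depth (u * D.refl i) = D.depth u + height (u.1 (D.simpleCoroot i)) := by
  simpa [D.height_simpleCoroot] using D.depth_mul_refl_mul u 1 i

theorem depth_inv (w : D.weylGroup) : D.depth w⁻¹ = D.depth w := by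
  induction w using D.weyl_induction_right with
  | one => rw [inv_one]
  | mul_refl w i ih =>
    have hleft := D.depth_mul_refl_mul 1 w⁻¹ i
    simp only [one_mul, one_apply, D.height_simpleCoroot, inv_inv] at hleft
    rw [mul_inv_rev, refl_inv, hleft, ih, depth_mul_refl]

theorem form_invSum_inv_self (w : D.weylGroup) :
    D.form (D.invSum w⁻¹) (D.invSum w⁻¹) = 2 * D.depth w := by
  rw [form_invSum, inv_inv, apply_invSum_inv, map_neg, ← depth, ← depth, depth_inv]
  ring

-- Cauchy-Schwarz for `γ` and `ρ - w⁻¹ρ`, whose pairing is `height γ - height (w γ)`.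
theorem height_sq_le_depth {w : D.weylGroup} {γ : I → ℤ} (hγ : D.IsRealCoroot γ) (h0 : 0 ≤ γ)
    (hw : w.1 γ ≤ 0) : height γ ^ 2 ≤ 4 * D.depth w := by
  have hsq := D.form_sq_le γ (D.invSum w⁻¹)
  rw [form_invSum_inv_self, hγ.form_self, form_invSum, inv_inv] at hsq
  have hneg : height (w.1 γ) ≤ 0 := by simpa using height_mono hw
  have hpos := height_nonneg h0
  nlinarith

theorem IsReduced.length_le_depth {D : AffineDatum I} {l : List I} (h : D.IsReduced l) :
    (l.length : ℤ) ≤ D.depth (D.wordProd l) := by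
  induction l using List.reverseRecOn with
  | nil => simp [depth_one]
  | append_singleton l i ih =>
    have hheight := (D.isRealCoroot_apply_simpleCoroot _ i).one_le_height h.apply_nonneg
    have hlen := ih h.left
    simp only [wordProd_append, wordProd_cons, wordProd_nil, mul_one, depth_mul_refl,
      List.length_append, List.length_singleton, Nat.cast_add, Nat.cast_one]
    exact add_le_add hlen hheight

theorem finite_depth_le (n : ℕ) : {w : D.weylGroup | D.depth w ≤ n}.Finite := by
  refine ((List.finite_length_le I n).image D.wordProd).subset fun w hw => ?_
  obtain ⟨l, hl, rfl⟩ := D.exists_isReduced_wordProd_eq w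
  exact ⟨l, Int.ofNat_le.mp (hl.length_le_depth.trans hw), rfl⟩

/-! ### Folded paths -/

/-- `FoldedPath l u σ`: a gallery of type `l` from `1` to `u`, folded at some of its walls; `σ` is
the sum of the coroots of the walls at which it is folded back to the side of `1`.  Such paths index
the terms in the expansion of `∏ T_i`, and `-σ` bounds the exponents of the corresponding term. -/
inductive FoldedPath : List I → D.weylGroup → (I → ℤ) → Prop
  | nil : FoldedPath [] 1 0
  | cross {l u σ} (i : I) : FoldedPath l u σ → FoldedPath (l ++ [i]) (u * D.refl i) σ
  | foldPos {l u σ} (i : I) : 0 ≤ u.1 (D.simpleCoroot i) → FoldedPath l u σ →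
      FoldedPath (l ++ [i]) u (σ + u.1 (D.simpleCoroot i))
  | foldNeg {l u σ} (i : I) : u.1 (D.simpleCoroot i) ≤ 0 → FoldedPath l u σ →
      FoldedPath (l ++ [i]) u σ

namespace FoldedPath

variable {D} {l : List I} {u : D.weylGroup} {σ : I → ℤ}

theorem nonneg (h : D.FoldedPath l u σ) : 0 ≤ σ := by
  induction h with
  | nil => exact le_rfl
  | cross _ _ ih => exact ih
  | foldPos _ hi _ ih => exact add_nonneg ih hi
  | foldNeg _ _ _ ih => exact ih

-- Removing the folds one at a time turns `u * wordProd m` into `wordProd (l ++ m)`; each removed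
-- positive fold at the coroot `β` increases the depth by at most `height β * M`.
theorem depth_le (h : D.FoldedPath l u σ) (m : List I) (hm : D.IsReduced (l ++ m)) {M : ℤ}
    (hM : ∀ γ, D.IsRealCoroot γ → 0 ≤ γ → (D.wordProd (l ++ m)).1 γ ≤ 0 → height γ ≤ M) :
    D.depth (D.wordProd (l ++ m)) ≤ D.depth (u * D.wordProd m) + height σ * M := by
  induction h generalizing m with
  | nil => simp
  | cross i _ ih =>
    rw [List.append_assoc] at hm hM ⊢
    simpa [mul_assoc] using ih ([i] ++ m) hm hM
  | @foldPos l u σ i hi _ ih =>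
    have hli : 0 ≤ (D.wordProd l).1 (D.simpleCoroot i) := hm.left.apply_nonneg
    rw [List.append_assoc] at hm hM ⊢
    have hmi : 0 ≤ (D.wordProd m)⁻¹.1 (D.simpleCoroot i) := hm.right.inv_apply_nonneg
    have hbound : height ((D.wordProd m)⁻¹.1 (D.simpleCoroot i)) ≤ M :=
      hM _ (D.isRealCoroot_apply_simpleCoroot _ i) hmi (by simpa using hli)
    have hunfold := ih ([i] ++ m) hm hM
    rw [wordProd_append D [i] m, wordProd_cons, wordProd_nil, mul_one, depth_mul_refl_mul]
      at hunfold
    rw [map_add, add_mul]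
    linarith [mul_le_mul_of_nonneg_left hbound (height_nonneg hi)]
  | @foldNeg l u σ i hi _ ih =>
    rw [List.append_assoc] at hm hM ⊢
    have hmi : 0 ≤ height ((D.wordProd m)⁻¹.1 (D.simpleCoroot i)) :=
      height_nonneg hm.right.inv_apply_nonneg
    have hui : height (u.1 (D.simpleCoroot i)) ≤ 0 := by simpa using height_mono hi
    have hunfold := ih ([i] ++ m) hm hM
    rw [wordProd_append D [i] m, wordProd_cons, wordProd_nil, mul_one, depth_mul_refl_mul]
      at hunfold
    linarith [mul_nonpos_of_nonpos_of_nonneg hui hmi]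

-- With `M = √(4 K)` the bound `K ≤ d + N M` of `depth_le` is quadratic in `M`.
theorem depth_le_of_height_le (h : D.FoldedPath l u σ) (hl : D.IsReduced l) {N : ℤ}
    (hN : height σ ≤ N) :
    D.depth (D.wordProd l) ≤ D.depth u + N * (4 * N + 4 * D.depth u + 1) := by
  obtain ⟨K, hK⟩ := Int.eq_ofNat_of_zero_le (D.depth_nonneg (D.wordProd l))
  have hroot (γ : I → ℤ) (hγ : D.IsRealCoroot γ) (h0 : 0 ≤ γ)
      (hw : (D.wordProd (l ++ [])).1 γ ≤ 0) : height γ ≤ Nat.sqrt (4 * K) := by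
    rw [List.append_nil] at hw
    have hsq := D.height_sq_le_depth hγ h0 hw
    obtain ⟨n, hn⟩ := Int.eq_ofNat_of_zero_le (height_nonneg h0)
    rw [hK, hn] at hsq
    rw [hn]
    exact_mod_cast Nat.le_sqrt'.mpr (by exact_mod_cast hsq)
  have hdepth := h.depth_le [] (by simpa using hl) hroot
  rw [List.append_nil, wordProd_nil, mul_one, hK] at hdepth
  have hM_sq : (Nat.sqrt (4 * K) : ℤ) ^ 2 ≤ 4 * K := by exact_mod_cast Nat.sqrt_le' (4 * K)
  have hu := D.depth_nonneg u
  have hN0 : 0 ≤ N := (height_nonneg h.nonneg).trans hN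
  have hlinear : (K : ℤ) ≤ D.depth u + N * Nat.sqrt (4 * K) :=
    hdepth.trans (by gcongr)
  have hM_le : (Nat.sqrt (4 * K) : ℤ) ≤ 4 * N + 4 * D.depth u + 1 := by
    by_contra! hcon
    nlinarith
  rw [hK]
  exact hlinear.trans (by gcongr)

end FoldedPath

theorem finite_setOf_foldedPath (u : D.weylGroup) (β : I → ℤ) :
    {w : D.weylGroup | ∃ l σ, D.IsReduced l ∧ D.wordProd l = w ∧ D.FoldedPath l u σ ∧
      σ ≤ β}.Finite := by
  let N := height β
  refine (D.finite_depth_le (D.depth u + N * (4 * N + 4 * D.depth u + 1)).toNat).subset ?_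
  rintro w ⟨l, σ, hl, rfl, hpath, hσ⟩
  exact (hpath.depth_le_of_height_le hl (height_mono hσ)).trans (Int.self_le_toNat _)

end AffineDatum

/-! ### Formal series -/

section Series

open OrderDual

variable {I : Type*}

/-- All exponents of the series `f` are `≤ μ`; thus `QFin I` consists of the series supported
below `0`. -/
def SupportedBelow (μ : I → ℤ) (f : CorootSeries I) : Prop :=
  ∀ γ : I → ℤ, f.coeff (toDual γ) ≠ 0 → γ ≤ μ

theorem exists_coeff_ne_zero_of_mul {f g : CorootSeries I} {γ : I → ℤ}
    (h : (f * g).coeff (toDual γ) ≠ 0) :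
    ∃ α β, f.coeff (toDual α) ≠ 0 ∧ g.coeff (toDual β) ≠ 0 ∧ α + β = γ := by
  obtain ⟨α, hα, β, hβ, rfl⟩ := Set.mem_add.mp (HahnSeries.support_mul_subset h)
  exact ⟨ofDual α, ofDual β, hα, hβ, rfl⟩

namespace SupportedBelow

variable {μ ν : I → ℤ} {f g : CorootSeries I}

theorem mono (h : SupportedBelow μ f) (hμ : μ ≤ ν) : SupportedBelow ν f :=
  fun γ hγ => (h γ hγ).trans hμ

theorem add (hf : SupportedBelow μ f) (hg : SupportedBelow μ g) : SupportedBelow μ (f + g) :=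
  fun γ h => (HahnSeries.support_add_subset f g h).elim (hf γ) (hg γ)

theorem sub (hf : SupportedBelow μ f) (hg : SupportedBelow μ g) : SupportedBelow μ (f - g) := by
  rw [sub_eq_add_neg]
  exact hf.add fun γ h => hg γ (by simpa using h)

theorem mul (hf : SupportedBelow μ f) (hg : SupportedBelow ν g) :
    SupportedBelow (μ + ν) (f * g) := by
  intro γ h
  obtain ⟨α, β, hα, hβ, rfl⟩ := exists_coeff_ne_zero_of_mul h
  exact add_le_add (hf α hα) (hg β hβ)

theorem single (γ : I → ℤ) (r : ℂ[X]) : SupportedBelow γ (HahnSeries.single (toDual γ) r) :=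
  fun _ h => (toDual.injective (HahnSeries.support_single_subset h)).le

theorem expS (γ : I → ℤ) : SupportedBelow γ (expS γ) := single γ 1

theorem vInvS : SupportedBelow 0 (vInvS I) := single 0 _

theorem one : SupportedBelow 0 (1 : CorootSeries I) := single 0 1

end SupportedBelow

@[simp]
theorem coeff_one_of_ne_zero {γ : I → ℤ} (h : γ ≠ 0) :
    (1 : CorootSeries I).coeff (toDual γ) = 0 :=
  HahnSeries.coeff_single_of_ne h

theorem expS_zero : expS (0 : I → ℤ) = 1 := rfl

theorem expS_mul_expS (γ δ : I → ℤ) : expS γ * expS δ = expS (γ + δ) := by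
  simp [expS, HahnSeries.single_mul_single]

theorem expS_mul_expS_neg (γ : I → ℤ) : expS γ * expS (-γ) = 1 := by
  rw [expS_mul_expS, add_neg_cancel, expS_zero]

theorem bddBelow_of_isWF {α : Type*} [LinearOrder α] [Nonempty α] {s : Set α} (hs : s.IsWF) :
    BddBelow s := by
  rcases s.eq_empty_or_nonempty with rfl | hne
  · exact bddBelow_empty
  · exact ⟨hs.min hne, fun _ hx => hs.min_le hne hx⟩

theorem exists_supportedBelow (f : CorootSeries I) : ∃ μ, SupportedBelow μ f := by
  have hbdd (i : I) : BddBelow ((fun x : (I → ℤ)ᵒᵈ => toDual (ofDual x i)) '' f.support) :=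
    bddBelow_of_isWF (f.isPWO_support.image_of_monotone fun _ _ hxy => hxy i).isWF
  choose m hm using hbdd
  exact ⟨fun i => ofDual (m i), fun γ hγ i => hm i (Set.mem_image_of_mem _ hγ)⟩

variable [Finite I]

/-- The inclusion of the power series in the `e^{-a_i^∨}` in the ring of formal series; its image
is `QFin I`. -/
def powerSeriesHom (I : Type*) [Finite I] : MvPowerSeries I ℂ[X] →+* CorootSeries I :=
  (HahnSeries.embDomainRingHom
    { toFun := fun n : I →₀ ℕ => toDual fun i => -(n i : ℤ)
      map_zero' := congrArg toDual (funext fun _ => neg_zero)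
      map_add' := fun m n => congrArg toDual (funext fun _ =>
        (congrArg Neg.neg (Nat.cast_add _ _)).trans (neg_add _ _)) }
    (fun m n h => by
      ext i
      simpa using congrFun (toDual.injective h) i)
    (fun m n => by
      change (∀ i, -(n i : ℤ) ≤ -(m i : ℤ)) ↔ m ≤ n
      simp [Finsupp.le_def])).comp
    (HahnSeries.toMvPowerSeries (σ := I) (R := ℂ[X])).symm.toRingHom

theorem coeff_powerSeriesHom (p : MvPowerSeries I ℂ[X]) (n : I →₀ ℕ) :
    (powerSeriesHom I p).coeff (toDual fun i => -(n i : ℤ)) = MvPowerSeries.coeff n p :=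
  HahnSeries.embDomain_coeff

theorem supportedBelow_powerSeriesHom (p : MvPowerSeries I ℂ[X]) :
    SupportedBelow 0 (powerSeriesHom I p) := by
  intro γ h
  obtain ⟨n, -, hn⟩ := HahnSeries.support_embDomain_subset h
  obtain rfl : (fun i => -(n i : ℤ)) = γ := toDual.injective hn
  exact fun i => by simp

theorem powerSeriesHom_injective : Function.Injective (powerSeriesHom I) :=
  HahnSeries.embDomain_injective.comp HahnSeries.toMvPowerSeries.symm.injective

theorem SupportedBelow.exists_powerSeries {f : CorootSeries I} (hf : SupportedBelow 0 f) :
    ∃ p, powerSeriesHom I p = f := by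
  let p : MvPowerSeries I ℂ[X] := fun n => f.coeff (toDual fun i => -(n i : ℤ))
  refine ⟨p, HahnSeries.ext (funext fun x => ?_)⟩
  obtain ⟨γ, rfl⟩ := toDual.surjective x
  by_cases h : γ ≤ 0
  · let n : I →₀ ℕ := Finsupp.equivFunOnFinite.symm fun i => (-γ i).toNat
    have hγ : γ = fun i => -(n i : ℤ) := funext fun i => by
      have : γ i ≤ 0 := h i
      simp only [n, Finsupp.equivFunOnFinite_symm_apply_apply]
      omega
    rw [hγ, coeff_powerSeriesHom]
    rfl
  · rw [not_not.mp (mt (hf _) h), not_not.mp (mt (supportedBelow_powerSeriesHom p _) h)]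

theorem SupportedBelow.exists_inverse {f : CorootSeries I} (hf : SupportedBelow 0 f)
    (h0 : f.coeff 0 = 1) : ∃ g, SupportedBelow 0 g ∧ f * g = 1 := by
  obtain ⟨p, rfl⟩ := hf.exists_powerSeries
  have hcoeff := coeff_powerSeriesHom p 0
  simp only [Finsupp.coe_zero, Pi.zero_apply, Nat.cast_zero, neg_zero] at hcoeff
  have hp : IsUnit p := by
    rw [MvPowerSeries.isUnit_iff_constantCoeff, ← MvPowerSeries.coeff_zero_eq_constantCoeff_apply,
      ← hcoeff]
    exact h0 ▸ isUnit_one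
  obtain ⟨q, hq⟩ := hp.exists_right_inv
  exact ⟨powerSeriesHom I q, supportedBelow_powerSeriesHom q, by rw [← map_mul, hq, map_one]⟩

-- Every series is a power series up to a monomial factor.
theorem exists_eq_expS_mul_powerSeriesHom (f : CorootSeries I) :
    ∃ μ p, f = expS μ * powerSeriesHom I p := by
  obtain ⟨μ, hμ⟩ := exists_supportedBelow f
  have hshift := (SupportedBelow.expS (-μ)).mul hμ
  rw [neg_add_cancel] at hshift
  obtain ⟨p, hp⟩ := hshift.exists_powerSeries
  exact ⟨μ, p, by rw [hp, ← mul_assoc, expS_mul_expS_neg, one_mul]⟩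

instance : NoZeroDivisors (CorootSeries I) where
  eq_zero_or_eq_zero_of_mul_eq_zero := by
    intro f g h
    obtain ⟨μ, p, rfl⟩ := exists_eq_expS_mul_powerSeriesHom f
    obtain ⟨ν, q, rfl⟩ := exists_eq_expS_mul_powerSeriesHom g
    have hpq : p * q = 0 := powerSeriesHom_injective <| by
      rw [map_mul, map_zero]
      linear_combination expS (-μ) * expS (-ν) * h - (powerSeriesHom I p * powerSeriesHom I q) *
        (expS μ * expS (-μ) * expS_mul_expS_neg ν + expS_mul_expS_neg μ)
    rcases mul_eq_zero.mp hpq with rfl | rfl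
    · exact Or.inl (by rw [map_zero, mul_zero])
    · exact Or.inr (by rw [map_zero, mul_zero])

end Series

/-! ### Rational functions and their expansions -/

section Expansion

variable {I : Type*}

@[simp]
theorem toSeries_single (γ : I → ℤ) (r : ℂ[X]) :
    toSeries I (AddMonoidAlgebra.single γ r) = HahnSeries.single (OrderDual.toDual γ) r := by
  rw [toSeries, AddMonoidAlgebra.lift_single]
  change r • HahnSeries.single (OrderDual.toDual γ) (1 : ℂ[X]) = _
  rw [← HahnSeries.single_zero_mul_eq_smul, HahnSeries.single_mul_single, zero_add, mul_one]

theorem coeff_toSeries (d : CorootAlg I) (γ : I → ℤ) :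
    (toSeries I d).coeff (OrderDual.toDual γ) = d.coeff γ := by
  classical
  induction d using AddMonoidAlgebra.induction_linear with
  | zero => simp
  | add f g hf hg => simp [hf, hg]
  | single δ r =>
    rw [toSeries_single, HahnSeries.coeff_single]
    simp [Finsupp.single_apply, eq_comm]

theorem toSeries_injective : Function.Injective (toSeries I) := fun d e h => by
  ext γ
  rw [← coeff_toSeries, h, coeff_toSeries]

theorem toSeries_ne_zero {d : CorootAlg I} (h : d ≠ 0) : toSeries I d ≠ 0 :=
  (map_ne_zero_iff _ toSeries_injective).mpr h

/-- The exponential `e^γ` in the group algebra. -/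
def expA (γ : I → ℤ) : CorootAlg I := AddMonoidAlgebra.single γ 1

/-- The element `v⁻¹` of the group algebra. -/
def vInvA (I : Type*) : CorootAlg I := AddMonoidAlgebra.single 0 X

@[simp]
theorem toSeries_expA (γ : I → ℤ) : toSeries I (expA γ) = expS γ := toSeries_single γ 1

@[simp]
theorem toSeries_vInvA : toSeries I (vInvA I) = vInvS I := toSeries_single 0 X

@[simp]
theorem expA_zero : expA (0 : I → ℤ) = 1 := rfl

theorem expA_mul_expA (γ δ : I → ℤ) : expA γ * expA δ = expA (γ + δ) := by
  simp [expA, AddMonoidAlgebra.single_mul_single]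

theorem one_sub_expA_dvd_one_sub_expA_zsmul (γ : I → ℤ) (n : ℤ) :
    1 - expA γ ∣ 1 - expA (n • γ) := by
  have hnat (m : ℕ) : 1 - expA γ ∣ 1 - expA (m • γ) := by
    have hpow : expA (m • γ) = expA γ ^ m := by
      simp [expA, AddMonoidAlgebra.single_pow]
    simpa only [hpow, one_pow] using sub_dvd_pow_sub_pow 1 (expA γ) m
  obtain ⟨m, rfl | rfl⟩ := n.eq_nat_or_neg
  · rw [natCast_zsmul]
    exact hnat m
  · have hinv : expA (-(m • γ)) * expA (m • γ) = 1 := by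
      rw [expA_mul_expA, neg_add_cancel, expA_zero]
    have hfactor : 1 - expA (-(m • γ)) = -expA (-(m • γ)) * (1 - expA (m • γ)) := by
      linear_combination -hinv
    rw [neg_smul, natCast_zsmul, hfactor]
    exact (hnat m).mul_left _

theorem one_sub_expA_ne_zero {γ : I → ℤ} (h : γ ≠ 0) : 1 - expA γ ≠ 0 := by
  intro heq
  have hcoeff := congrArg (fun d : CorootAlg I => d.coeff 0) heq
  simp [expA, AddMonoidAlgebra.one_def, h] at hcoeff

theorem one_sub_vInvA_mul_expA_ne_zero (γ : I → ℤ) : 1 - vInvA I * expA γ ≠ 0 := by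
  classical
  intro heq
  have hcoeff := congrArg (fun d : CorootAlg I => (d.coeff 0).coeff 0) heq
  simp only [vInvA, expA, AddMonoidAlgebra.single_mul_single, AddMonoidAlgebra.one_def] at hcoeff
  simp [Finsupp.single_apply] at hcoeff
  split_ifs at hcoeff <;> simp at hcoeff

theorem algebraMap_ne_zero {d : CorootAlg I} (h : d ≠ 0) :
    algebraMap (CorootAlg I) (RatFun I) d ≠ 0 :=
  (map_ne_zero_iff _ (IsFractionRing.injective _ _)).mpr h

theorem algebraMap_expA (γ : I → ℤ) : algebraMap (CorootAlg I) (RatFun I) (expA γ) = expR γ := rfl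

theorem algebraMap_vInvA : algebraMap (CorootAlg I) (RatFun I) (vInvA I) = vInvR I := rfl

theorem expR_zero : expR (0 : I → ℤ) = 1 := by
  rw [← algebraMap_expA, expA_zero, map_one]

theorem expR_add (γ δ : I → ℤ) : expR (γ + δ) = expR γ * expR δ := by
  simp only [← algebraMap_expA, ← expA_mul_expA, map_mul]

theorem expR_ne_zero (γ : I → ℤ) : expR γ ≠ 0 :=
  left_ne_zero_of_mul_eq_one (b := expR (-γ)) (by rw [← expR_add, add_neg_cancel, expR_zero])

theorem expR_neg (γ : I → ℤ) : expR (-γ) = (expR γ)⁻¹ :=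
  eq_inv_of_mul_eq_one_right (by rw [← expR_add, add_neg_cancel, expR_zero])

theorem one_sub_expR_ne_zero {γ : I → ℤ} (h : γ ≠ 0) : 1 - expR γ ≠ 0 := by
  rw [← algebraMap_expA, ← map_one (algebraMap (CorootAlg I) (RatFun I)), ← map_sub]
  exact algebraMap_ne_zero (one_sub_expA_ne_zero h)

theorem one_sub_vInvR_mul_expR_ne_zero (γ : I → ℤ) : 1 - vInvR I * expR γ ≠ 0 := by
  rw [← algebraMap_expA, ← algebraMap_vInvA, ← map_one (algebraMap (CorootAlg I) (RatFun I)),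
    ← map_mul, ← map_sub]
  exact algebraMap_ne_zero (one_sub_vInvA_mul_expA_ne_zero γ)

variable [Fintype I]

namespace IsExpansion

variable {r s : RatFun I} {f g : CorootSeries I}

theorem unique (h : IsExpansion r f) (h' : IsExpansion r g) : f = g := by
  obtain ⟨n, d, hd, hr, hf⟩ := h
  obtain ⟨n', d', hd', hr', hg⟩ := h'
  have hcross : n * d' = n' * d := IsFractionRing.injective (CorootAlg I) (RatFun I) <| by
    rw [map_mul, map_mul, ← hr, ← hr']
    ring
  have hseries := congrArg (toSeries I) hcross
  rw [map_mul, map_mul, ← hf, ← hg] at hseries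
  refine mul_right_cancel₀ (mul_ne_zero (toSeries_ne_zero hd) (toSeries_ne_zero hd')) ?_
  linear_combination hseries

theorem add (h : IsExpansion r f) (h' : IsExpansion s g) : IsExpansion (r + s) (f + g) := by
  obtain ⟨n, d, hd, hr, hf⟩ := h
  obtain ⟨n', d', hd', hs, hg⟩ := h'
  refine ⟨n * d' + n' * d, d * d', mul_ne_zero hd hd', ?_, ?_⟩
  · simp only [map_mul, map_add, ← hr, ← hs]
    ring
  · simp only [map_mul, map_add, ← hf, ← hg]
    ring

theorem mul (h : IsExpansion r f) (h' : IsExpansion s g) : IsExpansion (r * s) (f * g) := by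
  obtain ⟨n, d, hd, hr, hf⟩ := h
  obtain ⟨n', d', hd', hs, hg⟩ := h'
  refine ⟨n * n', d * d', mul_ne_zero hd hd', ?_, ?_⟩
  · rw [map_mul, map_mul, ← hr, ← hs, mul_mul_mul_comm]
  · rw [map_mul, map_mul, ← hf, ← hg, mul_mul_mul_comm]

theorem of_alg (d : CorootAlg I) :
    IsExpansion (algebraMap (CorootAlg I) (RatFun I) d) (toSeries I d) :=
  ⟨d, 1, one_ne_zero, by rw [map_one, mul_one], by rw [map_one, mul_one]⟩

theorem zero : IsExpansion (0 : RatFun I) 0 := by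
  simpa using of_alg (I := I) 0

theorem one : IsExpansion (1 : RatFun I) 1 := by
  simpa using of_alg (I := I) 1

theorem expR (γ : I → ℤ) : IsExpansion (expR γ) (expS γ) := by
  simpa [algebraMap_expA] using of_alg (expA γ)

theorem vInvR : IsExpansion (vInvR I) (vInvS I) := by
  simpa [algebraMap_vInvA] using of_alg (vInvA I)

theorem neg (h : IsExpansion r f) : IsExpansion (-r) (-f) := by
  obtain ⟨n, d, hd, hr, hf⟩ := h
  exact ⟨-n, d, hd, by rw [map_neg, neg_mul, hr], by rw [map_neg, ← hf]; ring⟩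

theorem sub (h : IsExpansion r f) (h' : IsExpansion s g) : IsExpansion (r - s) (f - g) := by
  simpa only [sub_eq_add_neg] using h.add h'.neg

theorem inv_alg {d : CorootAlg I} (h : toSeries I d * f = 1) :
    IsExpansion (algebraMap (CorootAlg I) (RatFun I) d)⁻¹ f := by
  have hd : d ≠ 0 := by
    rintro rfl
    simp at h
  refine ⟨1, d, hd, ?_, by rw [map_one, mul_comm, h]⟩
  rw [map_one, inv_mul_cancel₀ (algebraMap_ne_zero hd)]

end IsExpansion

end Expansion

section RationalFunctions

variable {I : Type*} {γ δ : I → ℤ}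

theorem one_sub_expR_inv : 1 - (expR γ)⁻¹ = -(1 - expR γ) / expR γ := by
  have := expR_ne_zero γ
  field_simp
  ring

variable [Fintype I]

theorem cFun_eq (h : γ ≠ 0) :
    cFun γ = (expR γ - vInvR I) / (expR γ * (1 - expR γ)) := by
  have := expR_ne_zero γ
  have := one_sub_expR_ne_zero h
  rw [cFun, expR_neg]
  field_simp

theorem cFun_neg_eq (h : γ ≠ 0) :
    cFun (-γ) = -(expR γ * (1 - vInvR I * expR γ)) / (1 - expR γ) := by
  have := expR_ne_zero γ
  have := one_sub_expR_ne_zero h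
  rw [cFun, neg_neg, expR_neg, one_sub_expR_inv]
  field_simp

theorem bFun_neg_eq (h : γ ≠ 0) :
    bFun (-γ) = -((vInvR I - 1) * expR γ) / (1 - expR γ) := by
  have := expR_ne_zero γ
  have := one_sub_expR_ne_zero h
  rw [bFun, expR_neg, one_sub_expR_inv]
  field_simp

theorem cFun_ne_zero (h : γ ≠ 0) : cFun γ ≠ 0 :=
  div_ne_zero (one_sub_vInvR_mul_expR_ne_zero _) (one_sub_expR_ne_zero h)

theorem bFun_ne_zero (h : γ ≠ 0) : bFun γ ≠ 0 := by
  have hnum := one_sub_vInvR_mul_expR_ne_zero (0 : I → ℤ)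
  rw [expR_zero, mul_one, sub_ne_zero] at hnum
  exact div_ne_zero (sub_ne_zero.mpr hnum.symm) (one_sub_expR_ne_zero h)

theorem bFun_mul_bFun (hγ : γ ≠ 0) (hδ : δ ≠ 0) (hγδ : γ + δ ≠ 0) :
    bFun (-γ) * bFun (γ + δ) + bFun δ * bFun γ = bFun (γ + δ) * bFun δ := by
  have h_gamma := one_sub_expR_ne_zero hγ
  have h_delta := one_sub_expR_ne_zero hδ
  have h_sum := one_sub_expR_ne_zero hγδ
  rw [bFun_neg_eq hγ, bFun, bFun, bFun]
  rw [expR_add] at h_sum ⊢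
  generalize expR γ = x at *
  generalize expR δ = y at *
  have : 1 - y * x ≠ 0 := by rwa [mul_comm]
  field_simp
  ring

theorem cFun_mul_bFun_mul_cFun (hγ : γ ≠ 0) (hδ : δ ≠ 0) (hγδ : γ + δ ≠ 0) :
    cFun γ * bFun (γ + δ) * cFun (-γ) + bFun γ * bFun δ * bFun γ =
      cFun δ * bFun (γ + δ) * cFun (-δ) + bFun δ * bFun γ * bFun δ := by
  have h_gamma := one_sub_expR_ne_zero hγ
  have h_delta := one_sub_expR_ne_zero hδ
  have h_sum := one_sub_expR_ne_zero hγδ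
  have hx := expR_ne_zero γ
  have hy := expR_ne_zero δ
  rw [cFun_eq hγ, cFun_eq hδ, cFun_neg_eq hγ, cFun_neg_eq hδ, bFun, bFun, bFun]
  rw [expR_add] at h_sum ⊢
  generalize expR γ = x at *
  generalize expR δ = y at *
  have : 1 - y * x ≠ 0 := by rwa [mul_comm]
  field_simp
  ring

end RationalFunctions

/-! ### The operators `T_i` -/

namespace AffineDatum

variable {I : Type*} [Fintype I] [DecidableEq I] (D : AffineDatum I)

theorem smul_single (w : D.weylGroup) (γ : I → ℤ) (r : ℂ[X]) :
    w • (AddMonoidAlgebra.single γ r : CorootAlg I) = AddMonoidAlgebra.single (w.1 γ) r :=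
  AddMonoidAlgebra.domCongr_single _ _ _

theorem smul_expA (w : D.weylGroup) (γ : I → ℤ) : w • expA γ = expA (w.1 γ) := D.smul_single w γ 1

theorem smul_vInvA (w : D.weylGroup) : w • vInvA I = vInvA I := by
  rw [vInvA, smul_single, map_zero]

theorem coeff_smul_apply (w : D.weylGroup) (d : CorootAlg I) (γ : I → ℤ) :
    (w • d).coeff (w.1 γ) = d.coeff γ := by
  change (AddMonoidAlgebra.domCongr ℂ[X] ℂ[X] w.1.toAddEquiv d).coeff (w.1 γ) = _
  rw [AddMonoidAlgebra.coeff_domCongr]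
  exact congrArg d.coeff (w.1.symm_apply_apply γ)

theorem smul_algebraMap (w : D.weylGroup) (d : CorootAlg I) :
    w • algebraMap (CorootAlg I) (RatFun I) d = algebraMap (CorootAlg I) (RatFun I) (w • d) :=
  IsFractionRing.ringEquivOfRingEquiv_algebraMap _ _

theorem smul_expR (w : D.weylGroup) (γ : I → ℤ) : w • expR γ = expR (w.1 γ) := by
  rw [← algebraMap_expA, smul_algebraMap, smul_expA, algebraMap_expA]

theorem smul_vInvR (w : D.weylGroup) : w • vInvR I = vInvR I := by
  rw [← algebraMap_vInvA, smul_algebraMap, smul_vInvA]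

theorem smul_div (w : D.weylGroup) (r s : RatFun I) : w • (r / s) = w • r / w • s :=
  map_div₀ (MulSemiringAction.toRingHom D.weylGroup (RatFun I) w) r s

theorem smul_cFun (w : D.weylGroup) (γ : I → ℤ) : w • cFun γ = cFun (w.1 γ) := by
  simp only [cFun, smul_div, smul_sub, smul_one, smul_mul', smul_expR, smul_vInvR, map_neg]

theorem smul_bFun (w : D.weylGroup) (γ : I → ℤ) : w • bFun γ = bFun (w.1 γ) := by
  simp only [bFun, smul_div, smul_sub, smul_one, smul_expR, smul_vInvR]

theorem coeff_mul_T (F : D.RW) (i : I) (u : D.weylGroup) :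
    (F * D.T i).coeff u = F.coeff (u * D.refl i) * cFun (-u.1 (D.simpleCoroot i)) +
      F.coeff u * bFun (u.1 (D.simpleCoroot i)) := by
  rw [T, mul_add, SkewMonoidAlgebra.coeff_add, Finsupp.add_apply,
    SkewMonoidAlgebra.coeff_mul_single, SkewMonoidAlgebra.coeff_mul_single_one, refl_inv,
    smul_cFun, smul_bFun, mul_apply, refl_simpleCoroot, map_neg]

theorem coeff_T_mul (F : D.RW) (i : I) (u : D.weylGroup) :
    (D.T i * F).coeff u = cFun (D.simpleCoroot i) * D.refl i • F.coeff (D.refl i * u) +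
      bFun (D.simpleCoroot i) * F.coeff u := by
  rw [T, add_mul, SkewMonoidAlgebra.coeff_add, Finsupp.add_apply,
    SkewMonoidAlgebra.coeff_single_mul, SkewMonoidAlgebra.coeff_single_mul, refl_inv,
    inv_one, one_mul, one_smul]

theorem coeff_mul_T_mul_T (F : D.RW) (i : I) (u : D.weylGroup) :
    (F * D.T i * D.T i).coeff u =
      (vInvR I - 1) * (F * D.T i).coeff u + vInvR I * F.coeff u := by
  have hne := D.apply_simpleCoroot_ne_zero u i
  have := expR_ne_zero (u.1 (D.simpleCoroot i))
  have := one_sub_expR_ne_zero hne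
  rw [coeff_mul_T, coeff_mul_T, coeff_mul_T]
  simp only [mul_refl_mul_refl, mul_apply, refl_simpleCoroot, map_neg, neg_neg]
  rw [cFun_eq hne, cFun_neg_eq hne, bFun_neg_eq hne, bFun]
  field_simp
  ring

theorem T_mul_T (i : I) : D.T i * D.T i =
    SkewMonoidAlgebra.single 1 (vInvR I - 1) * D.T i + SkewMonoidAlgebra.single 1 (vInvR I) := by
  classical
  ext u
  have hcoeff := D.coeff_mul_T_mul_T 1 i u
  rw [one_mul] at hcoeff
  rw [hcoeff, SkewMonoidAlgebra.coeff_add, Finsupp.add_apply, SkewMonoidAlgebra.coeff_single_mul,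
    inv_one, one_mul, one_smul, SkewMonoidAlgebra.coeff_one, SkewMonoidAlgebra.coeff_single,
    Finsupp.single_apply, Finsupp.single_apply, mul_ite, mul_one, mul_zero]

theorem coeff_T_mul_T_mul (F : D.RW) (i : I) (u : D.weylGroup) :
    (D.T i * (D.T i * F)).coeff u =
      (vInvR I - 1) * (D.T i * F).coeff u + vInvR I * F.coeff u := by
  rw [← mul_assoc, T_mul_T, add_mul, mul_assoc, SkewMonoidAlgebra.coeff_add, Finsupp.add_apply,
    SkewMonoidAlgebra.coeff_single_mul, SkewMonoidAlgebra.coeff_single_mul]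
  simp only [inv_one, one_smul, one_mul]

end AffineDatum

/-! ### Braid relations and reduced words -/

namespace AffineDatum

variable {I : Type*} [Fintype I] [DecidableEq I] (D : AffineDatum I) {i j : I}

theorem refl_simpleCoroot_of_A_eq_zero (h : D.A i j = 0) :
    (D.refl i).1 (D.simpleCoroot j) = D.simpleCoroot j := by
  rw [refl_apply, form_simpleCoroot, h, zero_smul, sub_zero]

theorem refl_simpleCoroot_of_A_eq_neg_one (h : D.A i j = -1) :
    (D.refl i).1 (D.simpleCoroot j) = D.simpleCoroot i + D.simpleCoroot j := by
  rw [refl_apply, form_simpleCoroot, h, neg_one_smul, sub_neg_eq_add, add_comm]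

theorem refl_mul_refl_of_A_eq_zero (h : D.A i j = 0) :
    D.refl i * D.refl j = D.refl j * D.refl i :=
  D.mul_refl_eq_refl_mul (Or.inl (D.refl_simpleCoroot_of_A_eq_zero h))

theorem refl_mul_refl_mul_refl_of_A_eq_neg_one (h : D.A i j = -1) :
    D.refl i * D.refl j * D.refl i = D.refl j * (D.refl i * D.refl j) := by
  refine D.mul_refl_eq_refl_mul (Or.inl ?_)
  rw [mul_apply, D.refl_simpleCoroot_of_A_eq_neg_one ((D.symm.apply i j).trans h), map_add,
    refl_simpleCoroot, D.refl_simpleCoroot_of_A_eq_neg_one h]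
  abel

theorem T_mul_T_of_A_eq_zero (h : D.A i j = 0) : D.T i * D.T j = D.T j * D.T i := by
  ext u
  rw [← one_mul (D.T i * D.T j), ← one_mul (D.T j * D.T i), ← mul_assoc, ← mul_assoc]
  simp only [coeff_mul_T, mul_apply, D.refl_simpleCoroot_of_A_eq_zero h,
    D.refl_simpleCoroot_of_A_eq_zero ((D.symm.apply i j).trans h)]
  rw [mul_assoc u, mul_assoc u, D.refl_mul_refl_of_A_eq_zero h]
  ring

theorem T_mul_T_mul_T_of_A_eq_neg_one (h : D.A i j = -1) :
    D.T i * D.T j * D.T i = D.T j * (D.T i * D.T j) := by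
  ext u
  have hij := D.refl_simpleCoroot_of_A_eq_neg_one h
  have hji := D.refl_simpleCoroot_of_A_eq_neg_one ((D.symm.apply i j).trans h)
  have hbraid : u * D.refl i * D.refl j * D.refl i = u * D.refl j * D.refl i * D.refl j := by
    simpa only [mul_assoc] using congrArg (u * ·) (D.refl_mul_refl_mul_refl_of_A_eq_neg_one h)
  rw [← one_mul (D.T i * _ * _), ← one_mul (D.T j * (D.T i * _)), ← mul_assoc, ← mul_assoc,
    ← mul_assoc, ← mul_assoc]
  generalize (1 : D.RW) = F
  have hα := D.apply_simpleCoroot_ne_zero u i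
  have hβ := D.apply_simpleCoroot_ne_zero u j
  have hαβ : u.1 (D.simpleCoroot i) + u.1 (D.simpleCoroot j) ≠ 0 := by
    simpa only [mul_apply, hij, map_add] using D.apply_simpleCoroot_ne_zero (u * D.refl i) j
  simp only [coeff_mul_T, mul_apply, hij, hji, refl_simpleCoroot, map_add, map_neg,
    mul_refl_mul_refl, neg_neg]
  rw [hbraid]
  generalize u.1 (D.simpleCoroot i) = α at *
  generalize u.1 (D.simpleCoroot j) = β at *
  have hbb := bFun_mul_bFun hα hβ hαβ
  have hbb' := bFun_mul_bFun hβ hα (by rwa [add_comm])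
  have hcbc := cFun_mul_bFun_mul_cFun hα hβ hαβ
  rw [add_comm β α] at hbb' ⊢
  rw [show α + β + -α = β by abel, show α + β + -β = α by abel]
  linear_combination F.coeff u * hcbc + F.coeff (u * D.refl i) * cFun (-α) * hbb -
    F.coeff (u * D.refl j) * cFun (-β) * hbb'

theorem IsReduced.inv_apply_nonpos {D : AffineDatum I} {l : List I} (h : D.IsReduced (i :: l)) :
    (D.wordProd (i :: l))⁻¹.1 (D.simpleCoroot i) ≤ 0 := by
  rw [wordProd_cons, mul_inv_rev, refl_inv, mul_apply, refl_simpleCoroot, map_neg]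
  exact neg_nonpos.mpr h.inv_apply_nonneg

-- Otherwise the form vanishes on `a_i^∨ + a_j^∨`, which is then imaginary and fixed by `w`.
theorem neg_one_le_A {w : D.weylGroup} (hi : w.1 (D.simpleCoroot i) ≤ 0)
    (hj : w.1 (D.simpleCoroot j) ≤ 0) : -1 ≤ D.A i j := by
  by_contra hlt
  let x := D.simpleCoroot i + D.simpleCoroot j
  have hform : D.form x x = 4 + 2 * D.A i j := by
    simp only [x, map_add, LinearMap.add_apply, form_simpleCoroot, D.diag, D.symm.apply i j]
    ring
  obtain ⟨n, hn⟩ := D.exists_eq_smul_c_of_form_self_eq_zero (x := x) <|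
    le_antisymm (by omega) (D.form_self_nonneg x)
  have hfix : w.1 x = x := by rw [hn, map_smul, apply_c]
  have hx : x ≤ 0 := by
    rw [← hfix, map_add]
    exact add_nonpos hi hj
  exact D.not_simpleCoroot_nonpos i
    ((le_add_of_nonneg_right (D.simpleCoroot_nonneg j)).trans hx)

theorem isReduced_cons_cons_of_A_eq_zero {w : D.weylGroup} (h : D.A i j = 0)
    (hi : w⁻¹.1 (D.simpleCoroot i) ≤ 0) (hj : w⁻¹.1 (D.simpleCoroot j) ≤ 0) {l : List I}
    (hl : D.IsReduced l) (hw : D.wordProd (i :: j :: l) = w) : D.IsReduced (i :: j :: l) := by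
  obtain rfl := hw
  have hij := D.refl_simpleCoroot_of_A_eq_zero h
  have hji := D.refl_simpleCoroot_of_A_eq_zero ((D.symm.apply i j).trans h)
  simp only [wordProd_cons, mul_inv_rev, refl_inv, mul_apply, refl_simpleCoroot, hij, hji,
    map_neg, neg_nonpos] at hi hj
  refine (hl.cons hj).cons ?_
  simpa only [wordProd_cons, mul_inv_rev, refl_inv, mul_apply, hji] using hi

theorem isReduced_cons_cons_cons_of_A_eq_neg_one {w : D.weylGroup} (h : D.A i j = -1)
    (hi : w⁻¹.1 (D.simpleCoroot i) ≤ 0) (hj : w⁻¹.1 (D.simpleCoroot j) ≤ 0) {l : List I}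
    (hl : D.IsReduced l) (hw : D.wordProd (i :: j :: i :: l) = w) :
    D.IsReduced (i :: j :: i :: l) := by
  obtain rfl := hw
  have hij := D.refl_simpleCoroot_of_A_eq_neg_one h
  have hji := D.refl_simpleCoroot_of_A_eq_neg_one ((D.symm.apply i j).trans h)
  simp only [wordProd_cons, mul_inv_rev, refl_inv, mul_apply, refl_simpleCoroot, hij, hji,
    map_neg, map_add, neg_nonpos, add_neg_cancel_comm] at hi hj
  rw [← sub_eq_add_neg, sub_nonpos, le_add_iff_nonneg_left] at hj
  refine ((hl.cons hj).cons ?_).cons ?_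
  · simpa only [wordProd_cons, mul_inv_rev, refl_inv, mul_apply, hij, map_add] using
      add_nonneg hj hi
  · simpa only [wordProd_cons, mul_inv_rev, refl_inv, mul_apply, hji, hij, map_add,
      refl_simpleCoroot, map_neg, add_neg_cancel_comm] using hi

theorem exists_isReduced_cons_cons {w : D.weylGroup} (hi : w⁻¹.1 (D.simpleCoroot i) ≤ 0)
    (hj : w⁻¹.1 (D.simpleCoroot j) ≤ 0) :
    ∃ l l', D.IsReduced (i :: l) ∧ D.IsReduced (j :: l') ∧ D.wordProd (i :: l) = w ∧
      D.wordProd (j :: l') = w ∧ ((i :: l).map D.T).prod = ((j :: l').map D.T).prod := by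
  rcases eq_or_ne i j with rfl | hij
  · obtain ⟨l, hl, hw⟩ := D.exists_isReduced_cons hi
    have hw' : D.wordProd (i :: l) = w := by rw [wordProd_cons, hw, refl_mul_refl_mul]
    exact ⟨l, l, hl, hl, hw', hw', rfl⟩
  have hle := D.offDiag i j hij
  have hge := D.neg_one_le_A hi hj
  obtain hA | hA : D.A i j = 0 ∨ D.A i j = -1 := by omega
  · obtain ⟨m, hm, hmw⟩ := D.exists_isReduced_wordProd_eq (D.refl j * (D.refl i * w))
    have hw : D.wordProd (i :: j :: m) = w := by simp [hmw]
    have hw' : D.wordProd (j :: i :: m) = w := by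
      rw [← hw]
      simp only [wordProd_cons, ← mul_assoc, D.refl_mul_refl_of_A_eq_zero hA]
    refine ⟨j :: m, i :: m, D.isReduced_cons_cons_of_A_eq_zero hA hi hj hm hw,
      D.isReduced_cons_cons_of_A_eq_zero ((D.symm.apply i j).trans hA) hj hi hm hw', hw, hw', ?_⟩
    simp only [List.map_cons, List.prod_cons, ← mul_assoc, D.T_mul_T_of_A_eq_zero hA]
  · obtain ⟨m, hm, hmw⟩ :=
      D.exists_isReduced_wordProd_eq (D.refl i * (D.refl j * (D.refl i * w)))
    have hw : D.wordProd (i :: j :: i :: m) = w := by simp [hmw]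
    have hw' : D.wordProd (j :: i :: j :: m) = w := by
      rw [← hw]
      simp only [wordProd_cons, ← mul_assoc, D.refl_mul_refl_mul_refl_of_A_eq_neg_one hA]
    refine ⟨j :: i :: m, i :: j :: m,
      D.isReduced_cons_cons_cons_of_A_eq_neg_one hA hi hj hm hw,
      D.isReduced_cons_cons_cons_of_A_eq_neg_one ((D.symm.apply i j).trans hA) hj hi hm hw',
      hw, hw', ?_⟩
    simp only [List.map_cons, List.prod_cons, ← mul_assoc, D.T_mul_T_mul_T_of_A_eq_neg_one hA]

-- Matsumoto's theorem: `exists_isReduced_cons_cons` interpolates between words with different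
-- first letters.
theorem prod_T_eq {l l' : List I} (hl : D.IsReduced l) (hl' : D.IsReduced l')
    (h : D.wordProd l = D.wordProd l') : (l.map D.T).prod = (l'.map D.T).prod := by
  induction hn : l.length generalizing l l' with
  | zero =>
    have hlen := hl.length_eq hl' h
    rw [List.length_eq_zero_iff.mp hn, List.length_eq_zero_iff.mp (hlen.symm.trans hn)]
  | succ n ih =>
    obtain ⟨i, l, rfl⟩ := List.exists_cons_of_length_eq_add_one hn
    obtain ⟨j, l', rfl⟩ :=
      List.exists_cons_of_length_eq_add_one ((hl.length_eq hl' h).symm.trans hn)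
    obtain ⟨m, m', hm, hm', hw, hw', hT⟩ :=
      D.exists_isReduced_cons_cons hl.inv_apply_nonpos (h ▸ hl'.inv_apply_nonpos)
    have tail_eq {k : I} {p q : List I} (hp : D.IsReduced (k :: p)) (hq : D.IsReduced (k :: q))
        (hpq : D.wordProd (k :: p) = D.wordProd (k :: q)) (hpn : (k :: p).length = n + 1) :
        ((k :: p).map D.T).prod = ((k :: q).map D.T).prod := by
      rw [List.map_cons, List.map_cons, List.prod_cons, List.prod_cons,
        ih (hp.right (l := [k])) (hq.right (l := [k])) (mul_left_cancel hpq)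
          (Nat.succ_injective hpn)]
    rw [tail_eq hl hm hw.symm hn, hT]
    exact tail_eq hm' hl' (hw'.trans h) ((hm'.length_eq hl hw').trans hn)

end AffineDatum

/-! ### The symmetrizer -/

section Fractions

variable {I : Type*} {β : I → ℤ}

theorem supportedBelow_toSeries_one_sub_expA (h : β ≤ 0) :
    SupportedBelow 0 (toSeries I (1 - expA β)) := by
  rw [map_sub, map_one, toSeries_expA]
  exact SupportedBelow.one.sub ((SupportedBelow.expS β).mono h)

theorem coeff_zero_toSeries_one_sub_expA (hβ : β ≠ 0) :
    (toSeries I (1 - expA β)).coeff 0 = 1 := by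
  rw [← toDual_zero, coeff_toSeries]
  simp [expA, AddMonoidAlgebra.one_def, hβ]

theorem exists_toSeries_one_sub_expA_mul_eq_one [Finite I] (h : β ≤ 0) (hβ : β ≠ 0) :
    ∃ g, SupportedBelow 0 g ∧ toSeries I (1 - expA β) * g = 1 :=
  (supportedBelow_toSeries_one_sub_expA h).exists_inverse (coeff_zero_toSeries_one_sub_expA hβ)

variable [Fintype I]

theorem isExpansion_inv_one_sub_expR {g : CorootSeries I}
    (hg : toSeries I (1 - expA β) * g = 1) : IsExpansion (1 - expR β)⁻¹ g := by
  simpa only [map_sub, map_one, algebraMap_expA] using IsExpansion.inv_alg hg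

theorem exists_isExpansion_inv_of_nonpos (h : β ≤ 0) (hβ : β ≠ 0) :
    ∃ g, IsExpansion (1 - expR β)⁻¹ g ∧ SupportedBelow 0 g := by
  obtain ⟨g, hg, hinv⟩ := exists_toSeries_one_sub_expA_mul_eq_one h hβ
  exact ⟨g, isExpansion_inv_one_sub_expR hinv, hg⟩

theorem exists_isExpansion_inv_of_nonneg (h : 0 ≤ β) (hβ : β ≠ 0) :
    ∃ g, IsExpansion (1 - expR β)⁻¹ g ∧ SupportedBelow (-β) g := by
  obtain ⟨g, hg, hsupp⟩ :=
    exists_isExpansion_inv_of_nonpos (neg_nonpos.mpr h) (neg_ne_zero.mpr hβ)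
  have hflip : (1 - expR β)⁻¹ = -expR (-β) * (1 - expR (-β))⁻¹ := by
    have := expR_ne_zero β
    have := one_sub_expR_ne_zero hβ
    rw [expR_neg, one_sub_expR_inv]
    field_simp
  refine ⟨-expS (-β) * g, hflip ▸ (IsExpansion.expR _).neg.mul hg, ?_⟩
  have hneg : SupportedBelow (-β) (-expS (-β)) := fun γ hγ =>
    SupportedBelow.expS (-β) γ (by simpa using hγ)
  simpa using hneg.mul hsupp

theorem exists_isExpansion_inv (h : 0 ≤ β ∨ β ≤ 0) (hβ : β ≠ 0) :
    ∃ g, IsExpansion (1 - expR β)⁻¹ g ∧ SupportedBelow (-β⁺) g := by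
  rcases h with h | h
  · rw [posPart_of_nonneg h]
    exact exists_isExpansion_inv_of_nonneg h hβ
  · rw [posPart_of_nonpos h, neg_zero]
    exact exists_isExpansion_inv_of_nonpos h hβ

theorem exists_isExpansion_bFun (h : 0 ≤ β ∨ β ≤ 0) (hβ : β ≠ 0) :
    ∃ g, IsExpansion (bFun β) g ∧ SupportedBelow (-β⁺) g := by
  obtain ⟨g, hg, hsupp⟩ := exists_isExpansion_inv h hβ
  exact ⟨(vInvS I - 1) * g, (IsExpansion.vInvR.sub IsExpansion.one).mul hg,
    by simpa using (SupportedBelow.vInvS.sub SupportedBelow.one).mul hsupp⟩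

theorem exists_isExpansion_cFun (h : 0 ≤ β ∨ β ≤ 0) (hβ : β ≠ 0) :
    ∃ g, IsExpansion (cFun β) g ∧ SupportedBelow (-β) g := by
  obtain ⟨g, hg, hsupp⟩ := exists_isExpansion_inv h hβ
  have hnum : IsExpansion (1 - vInvR I * expR (-β)) (1 - vInvS I * expS (-β)) :=
    IsExpansion.one.sub (IsExpansion.vInvR.mul (IsExpansion.expR _))
  have hnum_supp : SupportedBelow β⁻ (1 - vInvS I * expS (-β)) := by
    have hexp : SupportedBelow (-β) (vInvS I * expS (-β)) := by
      simpa using SupportedBelow.vInvS.mul (SupportedBelow.expS (-β))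
    exact (SupportedBelow.one.mono (negPart_nonneg β)).sub (hexp.mono (neg_le_negPart β))
  have hprod_supp := hnum_supp.mul hsupp
  rw [← sub_eq_add_neg, ← neg_sub, posPart_sub_negPart] at hprod_supp
  exact ⟨_, hnum.mul hg, hprod_supp⟩

end Fractions

namespace AffineDatum

variable {I : Type*} [Fintype I] [DecidableEq I] {D : AffineDatum I}

variable (D)

theorem exists_isExpansion_coeff_one (u : D.weylGroup) :
    ∃ f, IsExpansion ((1 : D.RW).coeff u) f ∧ ∀ γ, f.coeff (OrderDual.toDual γ) ≠ 0 →
      ∃ σ, D.FoldedPath [] u σ ∧ γ ≤ -D.invSum u - σ := by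
  classical
  rw [SkewMonoidAlgebra.coeff_one]
  rcases eq_or_ne u 1 with rfl | hu
  · rw [Finsupp.single_eq_same]
    refine ⟨1, IsExpansion.one, fun γ hγ => ⟨0, .nil, ?_⟩⟩
    simpa [invSum_one] using SupportedBelow.one γ hγ
  · rw [Finsupp.single_eq_of_ne hu]
    exact ⟨0, IsExpansion.zero, fun γ hγ => absurd HahnSeries.coeff_zero hγ⟩

-- Each factor `T_a` of the product contributes its `[w_a]` term, which crosses a wall, or
-- its `[1]` term, which folds the path at that wall.
theorem exists_isExpansion_prod_T (l : List I) (u : D.weylGroup) :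
    ∃ f, IsExpansion ((l.map D.T).prod.coeff u) f ∧ ∀ γ, f.coeff (OrderDual.toDual γ) ≠ 0 →
      ∃ σ, D.FoldedPath l u σ ∧ γ ≤ -D.invSum u - σ := by
  induction l using List.reverseRecOn generalizing u with
  | nil => exact D.exists_isExpansion_coeff_one u
  | append_singleton l i ih =>
    have hβ := D.isRealCoroot_apply_simpleCoroot u i
    obtain ⟨f, hf, hfσ⟩ := ih u
    obtain ⟨g, hg, hgσ⟩ := ih (u * D.refl i)
    obtain ⟨c, hc, hcsupp⟩ := exists_isExpansion_cFun hβ.neg.nonneg_or_nonpos hβ.neg.ne_zero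
    obtain ⟨b, hb, hbsupp⟩ := exists_isExpansion_bFun hβ.nonneg_or_nonpos hβ.ne_zero
    refine ⟨g * c + f * b, ?_, fun γ hγ => ?_⟩
    · rw [List.map_append, List.prod_append, List.map_singleton, List.prod_singleton, coeff_mul_T]
      exact (hg.mul hc).add (hf.mul hb)
    have hterm : (g * c).coeff (OrderDual.toDual γ) ≠ 0 ∨
        (f * b).coeff (OrderDual.toDual γ) ≠ 0 := by
      by_contra! hzero
      exact hγ (by rw [HahnSeries.coeff_add, hzero.1, hzero.2, add_zero])
    rcases hterm with hgc | hfb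
    · obtain ⟨x, y, hx, hy, rfl⟩ := exists_coeff_ne_zero_of_mul hgc
      obtain ⟨σ, hσ, hxσ⟩ := hgσ x hx
      refine ⟨σ, by simpa using hσ.cross i, (add_le_add hxσ (hcsupp y hy)).trans_eq ?_⟩
      rw [invSum_mul_refl]
      abel
    · obtain ⟨x, y, hx, hy, rfl⟩ := exists_coeff_ne_zero_of_mul hfb
      obtain ⟨σ, hσ, hxσ⟩ := hfσ x hx
      have hfold : D.FoldedPath (l ++ [i]) u (σ + (u.1 (D.simpleCoroot i))⁺) := by
        rcases hβ.nonneg_or_nonpos with hpos | hneg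
        · simpa only [posPart_of_nonneg hpos] using hσ.foldPos i hpos
        · simpa only [posPart_of_nonpos hneg, add_zero] using hσ.foldNeg i hneg
      refine ⟨_, hfold, (add_le_add hxσ (hbsupp y hy)).trans_eq ?_⟩
      abel

/-- The element `T_w`. -/
def heckeBasis (w : D.weylGroup) : D.RW :=
  ((D.exists_isReduced_wordProd_eq w).choose.map D.T).prod

variable {D} in
theorem IsReduced.prod_T {l : List I} (h : D.IsReduced l) :
    (l.map D.T).prod = D.heckeBasis (D.wordProd l) :=
  have hchoice := (D.exists_isReduced_wordProd_eq (D.wordProd l)).choose_spec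
  D.prod_T_eq h hchoice.1 hchoice.2.symm

theorem heckeBasis_mul_refl {w : D.weylGroup} {i : I} (h : 0 ≤ w.1 (D.simpleCoroot i)) :
    D.heckeBasis (w * D.refl i) = D.heckeBasis w * D.T i := by
  obtain ⟨l, hl, rfl⟩ := D.exists_isReduced_wordProd_eq w
  simpa [hl.prod_T] using (hl.append h).prod_T.symm

theorem heckeBasis_refl_mul {w : D.weylGroup} {i : I} (h : 0 ≤ w⁻¹.1 (D.simpleCoroot i)) :
    D.heckeBasis (D.refl i * w) = D.T i * D.heckeBasis w := by
  obtain ⟨l, hl, rfl⟩ := D.exists_isReduced_wordProd_eq w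
  simpa [hl.prod_T] using (hl.cons h).prod_T.symm

theorem exists_heckeCoeff (u w : D.weylGroup) :
    ∃ f, IsExpansion ((D.heckeBasis w).coeff u) f ∧ ∀ γ, f.coeff (OrderDual.toDual γ) ≠ 0 →
      ∃ l σ, D.IsReduced l ∧ D.wordProd l = w ∧ D.FoldedPath l u σ ∧ γ ≤ -D.invSum u - σ := by
  obtain ⟨l, hl, rfl⟩ := D.exists_isReduced_wordProd_eq w
  obtain ⟨f, hf, hpath⟩ := D.exists_isExpansion_prod_T l u
  refine ⟨f, hl.prod_T ▸ hf, fun γ hγ => ?_⟩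
  obtain ⟨σ, hσ⟩ := hpath γ hγ
  exact ⟨l, σ, hl, rfl, hσ⟩

/-- The expansion `C_u(w)` of the coefficient of `[u]` in `T_w`. -/
def heckeCoeff (u w : D.weylGroup) : CorootSeries I := (D.exists_heckeCoeff u w).choose

theorem isExpansion_heckeCoeff (u w : D.weylGroup) :
    IsExpansion ((D.heckeBasis w).coeff u) (D.heckeCoeff u w) :=
  (D.exists_heckeCoeff u w).choose_spec.1

theorem exists_foldedPath_of_coeff_heckeCoeff_ne_zero {u w : D.weylGroup} {γ : I → ℤ}
    (h : (D.heckeCoeff u w).coeff (OrderDual.toDual γ) ≠ 0) :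
    ∃ l σ, D.IsReduced l ∧ D.wordProd l = w ∧ D.FoldedPath l u σ ∧ γ ≤ -D.invSum u - σ :=
  (D.exists_heckeCoeff u w).choose_spec.2 γ h

theorem supportedBelow_heckeCoeff (u w : D.weylGroup) : SupportedBelow 0 (D.heckeCoeff u w) := by
  intro γ hγ
  obtain ⟨l, σ, -, -, hσ, hle⟩ := D.exists_foldedPath_of_coeff_heckeCoeff_ne_zero hγ
  exact hle.trans (sub_nonpos.mpr ((neg_nonpos.mpr (D.invSum_nonneg u)).trans hσ.nonneg))

theorem finite_setOf_coeff_heckeCoeff_ne_zero (u : D.weylGroup) (γ : I → ℤ) :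
    {w | (D.heckeCoeff u w).coeff (OrderDual.toDual γ) ≠ 0}.Finite := by
  refine (D.finite_setOf_foldedPath u (-γ)).subset fun w hw => ?_
  obtain ⟨l, σ, hl, hlw, hσ, hle⟩ := D.exists_foldedPath_of_coeff_heckeCoeff_ne_zero hw
  have hγσ : γ ≤ -σ := hle.trans (sub_le_iff_le_add.mpr (by simpa using D.invSum_nonneg u))
  exact ⟨l, σ, hl, hlw, hσ, le_neg_of_le_neg hγσ⟩

/-- The family `w ↦ C_u(w)`, which is summable since each `e^γ` occurs finitely often. -/
def heckeFamily (u : D.weylGroup) : HahnSeries.SummableFamily (I → ℤ)ᵒᵈ ℂ[X] D.weylGroup where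
  toFun := D.heckeCoeff u
  isPWO_iUnion_support' := isPWO_Iic_zero.mono <| Set.iUnion_subset fun w x hx =>
    D.supportedBelow_heckeCoeff u w (OrderDual.ofDual x) hx
  finite_co_support' x := D.finite_setOf_coeff_heckeCoeff_ne_zero u (OrderDual.ofDual x)

/-- The coefficients `C_u` of the symmetrizer `𝒫 = ∑_w T_w`. -/
def symmetrizer (u : D.weylGroup) : CorootSeries I := (D.heckeFamily u).hsum

theorem coeff_symmetrizer (u : D.weylGroup) (γ : I → ℤ) :
    (D.symmetrizer u).coeff (OrderDual.toDual γ) =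
      ∑ᶠ w, (D.heckeCoeff u w).coeff (OrderDual.toDual γ) :=
  HahnSeries.SummableFamily.coeff_hsum

theorem supportedBelow_symmetrizer (u : D.weylGroup) : SupportedBelow 0 (D.symmetrizer u) := by
  intro γ hγ
  rw [coeff_symmetrizer] at hγ
  obtain ⟨w, hw⟩ := not_forall.mp (mt finsum_eq_zero_of_forall_eq_zero hγ)
  exact D.supportedBelow_heckeCoeff u w γ hw

theorem isSymmetrizer_symmetrizer : D.IsSymmetrizer D.symmetrizer :=
  ⟨D.heckeCoeff, fun _ hl u => hl.prod_T ▸ D.isExpansion_heckeCoeff u _, fun u γ =>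
    ⟨D.finite_setOf_coeff_heckeCoeff_ne_zero u γ, D.coeff_symmetrizer u γ⟩⟩

variable {D} in
theorem IsSymmetrizer.eq_symmetrizer {P : D.weylGroup → CorootSeries I} (h : D.IsSymmetrizer P) :
    P = D.symmetrizer := by
  obtain ⟨C, hC, hP⟩ := h
  have hcoeff : C = D.heckeCoeff := by
    funext u w
    obtain ⟨l, hl, rfl⟩ := D.exists_isReduced_wordProd_eq w
    exact (hC l hl u).unique (hl.prod_T ▸ D.isExpansion_heckeCoeff u _)
  funext u
  ext x : 2
  exact (hP u (OrderDual.ofDual x)).2.trans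
    (hcoeff ▸ (D.coeff_symmetrizer u (OrderDual.ofDual x)).symm)

end AffineDatum

/-! ### Right multiplication -/

theorem finsum_eq_zero_of_add_apply_eq_zero {α M : Type*} [AddCommGroup M] [IsAddTorsionFree M]
    {f : α → M} (e : α ≃ α) (hf : f.HasFiniteSupport) (h : ∀ a, f a + f (e a) = 0) :
    ∑ᶠ a, f a = 0 := by
  have hsum := finsum_add_distrib hf (hf.preimage e.injective.injOn : (f ∘ e).HasFiniteSupport)
  simp only [h, finsum_zero, finsum_comp_equiv e] at hsum
  rw [← two_nsmul] at hsum
  exact (nsmul_eq_zero_iff_right two_ne_zero).mp hsum.symm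

namespace AffineDatum

variable {I : Type*} [Fintype I] [DecidableEq I] (D : AffineDatum I)

theorem smul_heckeFamily_apply (x : CorootSeries I) (u w : D.weylGroup) :
    (x • D.heckeFamily u) w = x * D.heckeCoeff u w := by
  rw [HahnSeries.SummableFamily.smul_apply, HahnSeries.of_symm_smul_of_eq_mul]
  rfl

theorem coeff_mul_symmetrizer (x : CorootSeries I) (u : D.weylGroup) (γ : I → ℤ) :
    (x * D.symmetrizer u).coeff (OrderDual.toDual γ) =
      ∑ᶠ w, (x * D.heckeCoeff u w).coeff (OrderDual.toDual γ) := by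
  rw [symmetrizer, ← HahnSeries.SummableFamily.hsum_smul,
    HahnSeries.SummableFamily.coeff_hsum]
  simp only [smul_heckeFamily_apply]

theorem hasFiniteSupport_coeff_mul_heckeCoeff (x : CorootSeries I) (u : D.weylGroup)
    (γ : I → ℤ) :
    Function.HasFiniteSupport fun w => (x * D.heckeCoeff u w).coeff (OrderDual.toDual γ) := by
  simpa only [smul_heckeFamily_apply] using
    (x • D.heckeFamily u).finite_co_support (OrderDual.toDual γ)

-- `T_{w w_a} = T_w T_a` for `w a^∨ > 0`, and `(1 + T_a) T_a = v⁻¹ (1 + T_a)`.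
theorem coeff_heckeBasis_add_mul_T (w u : D.weylGroup) (i : I) :
    ((D.heckeBasis w + D.heckeBasis (w * D.refl i)) * D.T i).coeff u =
      vInvR I * (D.heckeBasis w + D.heckeBasis (w * D.refl i)).coeff u := by
  wlog h : 0 ≤ w.1 (D.simpleCoroot i) generalizing w with H
  · have hflip := H (w * D.refl i) <| by
      simpa using (D.isRealCoroot_apply_simpleCoroot w i).not_nonneg_iff.mp h
    rwa [mul_refl_mul_refl, add_comm] at hflip
  · rw [add_mul, D.heckeBasis_mul_refl h, SkewMonoidAlgebra.coeff_add,
      SkewMonoidAlgebra.coeff_add, Finsupp.add_apply, Finsupp.add_apply, coeff_mul_T_mul_T]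
    ring

theorem isExpansion_coeff_heckeBasis_add (u w w' : D.weylGroup) :
    IsExpansion ((D.heckeBasis w + D.heckeBasis w').coeff u)
      (D.heckeCoeff u w + D.heckeCoeff u w') := by
  rw [SkewMonoidAlgebra.coeff_add, Finsupp.add_apply]
  exact (D.isExpansion_heckeCoeff u w).add (D.isExpansion_heckeCoeff u w')

section RightMul

variable {D} {i : I} {u : D.weylGroup} {c b : CorootSeries I}

theorem heckeCoeff_add_mul (hc : IsExpansion (cFun (-u.1 (D.simpleCoroot i))) c)
    (hb : IsExpansion (bFun (u.1 (D.simpleCoroot i))) b) (w : D.weylGroup) :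
    (D.heckeCoeff (u * D.refl i) w + D.heckeCoeff (u * D.refl i) (w * D.refl i)) * c +
      (D.heckeCoeff u w + D.heckeCoeff u (w * D.refl i)) * b =
      vInvS I * (D.heckeCoeff u w + D.heckeCoeff u (w * D.refl i)) := by
  have hright := ((D.isExpansion_coeff_heckeBasis_add (u * D.refl i) w (w * D.refl i)).mul hc).add
    ((D.isExpansion_coeff_heckeBasis_add u w (w * D.refl i)).mul hb)
  rw [← coeff_mul_T, coeff_heckeBasis_add_mul_T] at hright
  exact hright.unique (IsExpansion.vInvR.mul (D.isExpansion_coeff_heckeBasis_add u w _))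

-- The terms for `w` and `w w_a` of `𝒫 (T_a - v⁻¹)` cancel.
theorem symmetrizer_mul (hc : IsExpansion (cFun (-u.1 (D.simpleCoroot i))) c)
    (hb : IsExpansion (bFun (u.1 (D.simpleCoroot i))) b) :
    D.symmetrizer (u * D.refl i) * c + D.symmetrizer u * b = vInvS I * D.symmetrizer u := by
  suffices hzero : c * D.symmetrizer (u * D.refl i) + (b - vInvS I) * D.symmetrizer u = 0 by
    linear_combination hzero
  ext x : 2
  obtain ⟨γ, rfl⟩ := OrderDual.toDual.surjective x
  have hfin := D.hasFiniteSupport_coeff_mul_heckeCoeff c (u * D.refl i) γ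
  have hfin' := D.hasFiniteSupport_coeff_mul_heckeCoeff (b - vInvS I) u γ
  rw [HahnSeries.coeff_add, coeff_mul_symmetrizer, coeff_mul_symmetrizer,
    ← finsum_add_distrib hfin hfin']
  refine finsum_eq_zero_of_add_apply_eq_zero (Equiv.mulRight (D.refl i)) (hfin.add hfin')
    fun w => ?_
  simp only [Equiv.coe_mulRight, ← HahnSeries.coeff_add]
  convert HahnSeries.coeff_zero using 2
  linear_combination heckeCoeff_add_mul hc hb w

end RightMul

theorem refl_ne_one (i : I) : D.refl i ≠ 1 := fun h => by
  have hflip := congrFun (D.refl_simpleCoroot i) i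
  simp [h, simpleCoroot] at hflip

open scoped Classical in
theorem coeff_T (i : I) (y : D.weylGroup) : (D.T i).coeff y =
    Finsupp.single (D.refl i) (cFun (D.simpleCoroot i)) y +
      Finsupp.single 1 (bFun (D.simpleCoroot i)) y := by
  rw [T, SkewMonoidAlgebra.coeff_add, Finsupp.add_apply, SkewMonoidAlgebra.coeff_single,
    SkewMonoidAlgebra.coeff_single]

theorem coeff_T_refl (i : I) : (D.T i).coeff (D.refl i) = cFun (D.simpleCoroot i) := by
  rw [coeff_T, Finsupp.single_eq_same, Finsupp.single_eq_of_ne (D.refl_ne_one i), add_zero]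

theorem coeff_T_one (i : I) : (D.T i).coeff 1 = bFun (D.simpleCoroot i) := by
  rw [coeff_T, Finsupp.single_eq_same, Finsupp.single_eq_of_ne (D.refl_ne_one i).symm, zero_add]

open scoped Classical in
theorem support_T (i : I) : (D.T i).support = {D.refl i, 1} := by
  have hne : D.simpleCoroot i ≠ 0 := D.apply_simpleCoroot_ne_zero 1 i
  ext y
  rw [SkewMonoidAlgebra.mem_support_iff, Finset.mem_insert, Finset.mem_singleton]
  refine ⟨fun h => ?_, ?_⟩
  · by_contra! hy
    exact h (by rw [coeff_T, Finsupp.single_eq_of_ne hy.1, Finsupp.single_eq_of_ne hy.2, add_zero])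
  · rintro (rfl | rfl)
    · exact (D.coeff_T_refl i).trans_ne (cFun_ne_zero hne)
    · exact (D.coeff_T_one i).trans_ne (bFun_ne_zero hne)

theorem forall_mem_support_T {i : I} {p : D.weylGroup → Prop} :
    (∀ y ∈ (D.T i).support, p y) ↔ p (D.refl i) ∧ p 1 := by
  classical
  simp only [support_T, Finset.mem_insert, Finset.mem_singleton, forall_eq_or_imp, forall_eq]

theorem sum_support_T (i : I) (f : D.weylGroup → CorootSeries I) :
    ∑ y ∈ (D.T i).support, f y = f (D.refl i) + f 1 := by
  classical
  rw [support_T, Finset.sum_pair (D.refl_ne_one i)]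

theorem isRightProd_T_symmetrizer (i : I) :
    D.IsRightProd D.symmetrizer (D.T i) (fun u => vInvS I * D.symmetrizer u) := by
  classical
  have hreal (u : D.weylGroup) := D.isRealCoroot_apply_simpleCoroot u i
  choose c hc using fun u =>
    exists_isExpansion_cFun (hreal u).neg.nonneg_or_nonpos (hreal u).neg.ne_zero
  choose b hb using fun u => exists_isExpansion_bFun (hreal u).nonneg_or_nonpos (hreal u).ne_zero
  refine ⟨Function.update (fun _ => b) (D.refl i) c,
    D.forall_mem_support_T.mpr ⟨fun u => ?_, fun u => ?_⟩, fun u => ?_⟩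
  · rw [Function.update_self, coeff_T_refl, smul_cFun, refl_inv, mul_apply, refl_simpleCoroot,
      map_neg]
    exact (hc u).1
  · rw [Function.update_of_ne (D.refl_ne_one i).symm, coeff_T_one, smul_bFun, inv_one, mul_one]
    exact (hb u).1
  · rw [sum_support_T, Function.update_self, Function.update_of_ne (D.refl_ne_one i).symm,
      refl_inv, inv_one, mul_one]
    exact (symmetrizer_mul (hc u).1 (hb u).1).symm

end AffineDatum

/-! ### Rational functions without a pole along `e^{a_i} = 1` -/

section Inverse

variable {I : Type*} [Finite I] {f g : CorootSeries I}

-- Induction on the height: `g = 1 - (f - 1) g`, and `f - 1` only involves exponents of smaller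
-- height than `0`.
theorem SupportedBelow.mem_of_coeff_inverse_ne_zero (hf : SupportedBelow 0 f)
    (hf₀ : f.coeff 0 = 1) (hg : SupportedBelow 0 g) (hfg : f * g = 1) {S : AddSubmonoid (I → ℤ)}
    (hS : ∀ γ, f.coeff (OrderDual.toDual γ) ≠ 0 → γ ∈ S) {γ : I → ℤ}
    (hγ : g.coeff (OrderDual.toDual γ) ≠ 0) : γ ∈ S := by
  have := Fintype.ofFinite I
  obtain ⟨n, hn⟩ : ∃ n : ℕ, height (-γ) = n :=
    Int.eq_ofNat_of_zero_le (height_nonneg (neg_nonneg.mpr (hg γ hγ)))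
  induction n using Nat.strong_induction_on generalizing γ with
  | _ n ih =>
  rcases eq_or_ne γ 0 with rfl | hγ₀
  · exact S.zero_mem
  have hrec : ((f - 1) * g).coeff (OrderDual.toDual γ) ≠ 0 := by
    rw [sub_mul, hfg, one_mul, HahnSeries.coeff_sub, coeff_one_of_ne_zero hγ₀,
      zero_sub]
    exact neg_ne_zero.mpr hγ
  obtain ⟨α, β, hα, hβ, rfl⟩ := exists_coeff_ne_zero_of_mul hrec
  have hα₀ : α ≠ 0 := by
    rintro rfl
    exact hα (by rw [HahnSeries.coeff_sub, toDual_zero, hf₀, HahnSeries.coeff_one, if_pos rfl,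
      sub_self])
  rw [HahnSeries.coeff_sub, coeff_one_of_ne_zero hα₀, sub_zero] at hα
  have hpos : 0 < height (-α) := height_pos (neg_nonneg.mpr (hf α hα)) (neg_ne_zero.mpr hα₀)
  obtain ⟨m, hm⟩ : ∃ m : ℕ, height (-β) = m :=
    Int.eq_ofNat_of_zero_le (height_nonneg (neg_nonneg.mpr (hg β hβ)))
  rw [neg_add, map_add] at hn
  exact S.add_mem (hS α hα) (ih m (by lia) hβ hm)

end Inverse

namespace AffineDatum

variable {I : Type*} [Fintype I] [DecidableEq I] {D : AffineDatum I}

/-- Termwise application of `w`: the series `g` is obtained from `f` by moving the coefficient of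
`e^γ` to `e^{wγ}`. -/
def Permuted (w : D.weylGroup) (f g : CorootSeries I) : Prop :=
  ∀ γ : I → ℤ, g.coeff (OrderDual.toDual (w.1 γ)) = f.coeff (OrderDual.toDual γ)

namespace Permuted

variable {w : D.weylGroup} {f g f' g' : CorootSeries I}

theorem unique (h : Permuted w f g) (h' : Permuted w f g') : g = g' := by
  ext x : 2
  obtain ⟨γ, rfl⟩ := OrderDual.toDual.surjective x
  rw [← D.apply_inv_apply w γ, h, h']

theorem symm (h : Permuted w f g) : Permuted w⁻¹ g f := fun γ => by
  rw [← h, apply_inv_apply]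

theorem trans {w' : D.weylGroup} (h : Permuted w f g) (h' : Permuted w' g g') :
    Permuted (w' * w) f g' := fun γ => by
  rw [mul_apply, h', h]

theorem toSeries (w : D.weylGroup) (d : CorootAlg I) :
    Permuted w (toSeries I d) (toSeries I (w • d)) := fun γ => by
  rw [coeff_toSeries, coeff_toSeries, coeff_smul_apply]

theorem one : Permuted w 1 1 := by
  simpa only [map_one, smul_one] using toSeries w 1

theorem add (h : Permuted w f g) (h' : Permuted w f' g') : Permuted w (f + f') (g + g') :=
  fun γ => by rw [HahnSeries.coeff_add, HahnSeries.coeff_add, h, h']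

theorem neg (h : Permuted w f g) : Permuted w (-f) (-g) := fun γ => by
  rw [HahnSeries.coeff_neg, HahnSeries.coeff_neg, h]

theorem mul (h : Permuted w f g) (h' : Permuted w f' g') : Permuted w (f * f') (g * g') := by
  intro γ
  rw [HahnSeries.coeff_mul, HahnSeries.coeff_mul]
  let e : (I → ℤ)ᵒᵈ ≃ (I → ℤ)ᵒᵈ := w.1.toEquiv
  have hcoeff {k k' : CorootSeries I} (hk : Permuted w k k') (x : (I → ℤ)ᵒᵈ) :
      k'.coeff (e x) = k.coeff x := hk (OrderDual.ofDual x)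
  have hsum (x y : (I → ℤ)ᵒᵈ) : e x + e y = e (OrderDual.toDual γ) ↔ x + y = OrderDual.toDual γ :=
    (congrArg (· = e (OrderDual.toDual γ)) (map_add w.1 _ _).symm).to_iff.trans e.apply_eq_iff_eq
  refine (Finset.sum_equiv (e.prodCongr e) (fun p => ?_) fun p _ => ?_).symm
  · simp only [Finset.mem_antidiagonal, HahnSeries.mem_support, Equiv.prodCongr_apply,
      Prod.map_fst, Prod.map_snd, hcoeff h, hcoeff h']
    exact and_congr_right' (and_congr_right' (hsum _ _).symm)
  · simp only [Equiv.prodCongr_apply, Prod.map_fst, Prod.map_snd, hcoeff h, hcoeff h']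

theorem inverse (h : Permuted w f g) (hf : SupportedBelow 0 f) (hg : SupportedBelow 0 g)
    (hf₀ : f.coeff 0 = 1) (hf' : SupportedBelow 0 f') (hff' : f * f' = 1) (hgg' : g * g' = 1) :
    Permuted w f' g' := by
  have hsupp : ∀ γ, f'.coeff (OrderDual.toDual γ) ≠ 0 → w.1 γ ≤ 0 := fun γ hγ =>
    neg_nonneg.mp <| hf.mem_of_coeff_inverse_ne_zero hf₀ hf' hff'
      (S := (AddSubmonoid.nonneg (I → ℤ)).comap (-w.1.toLinearMap).toAddMonoidHom)
      (fun δ hδ => neg_nonneg.mpr (hg _ ((h δ).trans_ne hδ))) hγ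
  let moved : CorootSeries I :=
    { coeff := fun x => f'.coeff (OrderDual.toDual (w⁻¹.1 (OrderDual.ofDual x)))
      isPWO_support' := isPWO_Iic_zero.mono fun x hx => by
        have hle := hsupp _ hx
        rwa [apply_inv_apply] at hle }
  have hmoved : Permuted w f' moved := fun γ =>
    congrArg (fun δ => f'.coeff (OrderDual.toDual δ)) (D.inv_apply_apply w γ)
  have hinv : g * moved = 1 := (hff' ▸ h.mul hmoved).unique one
  rwa [← left_inv_eq_right_inv ((mul_comm g' g).trans hgg') hinv] at hmoved

end Permuted

variable (D) in
/-- The subring of the rational functions `r` such that `r` and `w_i r` have expansions which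
correspond to each other termwise.  It serves as an algebraic substitute for the functions which
have no pole along `e^{a_i} = 1`, the only wall that `w_i` moves across the domain of expansion. -/
def regularSubring (i : I) : Subring (RatFun I) where
  carrier := {r | ∃ f g, IsExpansion r f ∧ IsExpansion (D.refl i • r) g ∧ Permuted (D.refl i) f g}
  mul_mem' := by
    rintro r s ⟨f, g, hf, hg, h⟩ ⟨f', g', hf', hg', h'⟩
    exact ⟨f * f', g * g', hf.mul hf', by rw [smul_mul']; exact hg.mul hg', h.mul h'⟩
  one_mem' := ⟨1, 1, .one, by rw [smul_one]; exact .one, .one⟩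
  add_mem' := by
    rintro r s ⟨f, g, hf, hg, h⟩ ⟨f', g', hf', hg', h'⟩
    exact ⟨f + f', g + g', hf.add hf', by rw [smul_add]; exact hg.add hg', h.add h'⟩
  zero_mem' := ⟨0, 0, .zero, by rw [smul_zero]; exact .zero, fun _ => rfl⟩
  neg_mem' := by
    rintro r ⟨f, g, hf, hg, h⟩
    exact ⟨-f, -g, hf.neg, by rw [smul_neg]; exact hg.neg, h.neg⟩

section RegularSubring

variable {i : I} {r : RatFun I} {β : I → ℤ}

theorem permuted_of_mem_regularSubring (h : r ∈ D.regularSubring i) {f g : CorootSeries I}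
    (hf : IsExpansion r f) (hg : IsExpansion (D.refl i • r) g) : Permuted (D.refl i) f g := by
  obtain ⟨f', g', hf', hg', hperm⟩ := h
  rwa [hf.unique hf', hg.unique hg']

theorem algebraMap_mem_regularSubring (d : CorootAlg I) :
    algebraMap (CorootAlg I) (RatFun I) d ∈ D.regularSubring i :=
  ⟨_, _, .of_alg d, by rw [smul_algebraMap]; exact .of_alg _, .toSeries _ d⟩

theorem expR_mem_regularSubring (γ : I → ℤ) : expR γ ∈ D.regularSubring i :=
  algebraMap_mem_regularSubring (expA γ)

theorem vInvR_mem_regularSubring : vInvR I ∈ D.regularSubring i :=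
  algebraMap_mem_regularSubring (vInvA I)

theorem refl_smul_mem_regularSubring (h : r ∈ D.regularSubring i) :
    D.refl i • r ∈ D.regularSubring i := by
  obtain ⟨f, g, hf, hg, hfg⟩ := h
  exact ⟨g, f, hg, by rwa [smul_smul, refl_mul_self, one_smul], D.refl_inv i ▸ hfg.symm⟩

theorem inv_one_sub_expR_mem_regularSubring_of_nonpos (h : β ≤ 0) (h' : (D.refl i).1 β ≤ 0)
    (hβ : β ≠ 0) : (1 - expR β)⁻¹ ∈ D.regularSubring i := by
  have hβ' : (D.refl i).1 β ≠ 0 := (map_ne_zero_iff _ (D.refl i).1.injective).mpr hβ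
  obtain ⟨g, hg, hinv⟩ := exists_toSeries_one_sub_expA_mul_eq_one h hβ
  obtain ⟨g', -, hinv'⟩ := exists_toSeries_one_sub_expA_mul_eq_one h' hβ'
  have hperm := Permuted.toSeries (D.refl i) (1 - expA β)
  rw [smul_sub, smul_one, smul_expA] at hperm
  refine ⟨g, g', isExpansion_inv_one_sub_expR hinv, ?_,
    hperm.inverse (supportedBelow_toSeries_one_sub_expA h)
      (supportedBelow_toSeries_one_sub_expA h') (coeff_zero_toSeries_one_sub_expA hβ) hg hinv hinv'⟩
  rw [smul_inv'', smul_sub, smul_one, smul_expR]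
  exact isExpansion_inv_one_sub_expR hinv'

theorem IsRealCoroot.inv_one_sub_expR_mem_regularSubring (hβ : D.IsRealCoroot β)
    (hne : β ≠ D.simpleCoroot i) (hne' : β ≠ -D.simpleCoroot i) :
    (1 - expR β)⁻¹ ∈ D.regularSubring i := by
  have hneg {β : I → ℤ} (hβ : D.IsRealCoroot β) (h : β ≤ 0) (hne : β ≠ -D.simpleCoroot i) :
      (1 - expR β)⁻¹ ∈ D.regularSubring i := by
    refine inv_one_sub_expR_mem_regularSubring_of_nonpos h ?_ hβ.ne_zero
    rw [← neg_nonneg, ← map_neg]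
    exact hβ.neg.refl_nonneg (neg_nonneg.mpr h) (neg_eq_iff_eq_neg.not.mpr hne)
  rcases hβ.nonneg_or_nonpos with h | h
  · have hflip : (1 - expR β)⁻¹ = 1 - (1 - expR (-β))⁻¹ := by
      have := expR_ne_zero β
      have := one_sub_expR_ne_zero hβ.ne_zero
      rw [expR_neg, one_sub_expR_inv]
      field_simp
      ring
    rw [hflip]
    exact sub_mem (one_mem _) (hneg hβ.neg (neg_nonpos.mpr h) (neg_injective.ne hne))
  · exact hneg hβ h hne'

end RegularSubring

variable (D) in
/-- The subring of the regular functions `r` which are congruent to `w_i r` modulo `1 - e^{a_i}`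
within the regular functions. -/
def stronglyRegularSubring (i : I) : Subring (RatFun I) where
  carrier := {r | r ∈ D.regularSubring i ∧
    (r - D.refl i • r) / (1 - expR (D.simpleCoroot i)) ∈ D.regularSubring i}
  mul_mem' := by
    rintro r s ⟨hr, hr'⟩ ⟨hs, hs'⟩
    refine ⟨mul_mem hr hs, ?_⟩
    convert add_mem (mul_mem hr' hs) (mul_mem (refl_smul_mem_regularSubring hr) hs') using 1
    rw [smul_mul']
    ring
  one_mem' := ⟨one_mem _, by rw [smul_one, sub_self, zero_div]; exact zero_mem _⟩
  add_mem' := by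
    rintro r s ⟨hr, hr'⟩ ⟨hs, hs'⟩
    refine ⟨add_mem hr hs, ?_⟩
    convert add_mem hr' hs' using 1
    rw [smul_add]
    ring
  zero_mem' := ⟨zero_mem _, by rw [smul_zero, sub_self, zero_div]; exact zero_mem _⟩
  neg_mem' := by
    rintro r ⟨hr, hr'⟩
    refine ⟨neg_mem hr, ?_⟩
    convert neg_mem hr' using 1
    rw [smul_neg]
    ring

section StronglyRegularSubring

variable {i : I} {r : RatFun I} {β : I → ℤ}

theorem vInvR_mem_stronglyRegularSubring : vInvR I ∈ D.stronglyRegularSubring i :=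
  ⟨vInvR_mem_regularSubring, by rw [smul_vInvR, sub_self, zero_div]; exact zero_mem _⟩

theorem expR_mem_stronglyRegularSubring (γ : I → ℤ) :
    expR γ ∈ D.stronglyRegularSubring i := by
  refine ⟨expR_mem_regularSubring γ, ?_⟩
  obtain ⟨p, hp⟩ := one_sub_expA_dvd_one_sub_expA_zsmul (D.simpleCoroot i)
    (-D.form (D.simpleCoroot i) γ)
  have hne := one_sub_expR_ne_zero (D.isRealCoroot_simpleCoroot i).ne_zero
  have hrefl : (D.refl i).1 γ = γ + -D.form (D.simpleCoroot i) γ • D.simpleCoroot i := by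
    rw [refl_apply, neg_smul, sub_eq_add_neg]
  have hquot : (expR γ - D.refl i • expR γ) / (1 - expR (D.simpleCoroot i)) =
      algebraMap (CorootAlg I) (RatFun I) (expA γ * p) := by
    have hp' := congrArg (algebraMap (CorootAlg I) (RatFun I)) hp
    simp only [map_sub, map_mul, map_one, algebraMap_expA] at hp'
    rw [div_eq_iff hne, smul_expR, hrefl, expR_add, map_mul, algebraMap_expA]
    linear_combination expR γ * hp'
  rw [hquot]
  exact algebraMap_mem_regularSubring _

theorem inv_mem_stronglyRegularSubring (h : r ∈ D.stronglyRegularSubring i)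
    (hinv : r⁻¹ ∈ D.regularSubring i) : r⁻¹ ∈ D.stronglyRegularSubring i := by
  rcases eq_or_ne r 0 with rfl | hr
  · rwa [inv_zero] at *
  refine ⟨hinv, ?_⟩
  have hr' : D.refl i • r ≠ 0 := (smul_ne_zero_iff_ne _).mpr hr
  convert neg_mem (mul_mem (mul_mem h.2 hinv) (refl_smul_mem_regularSubring hinv)) using 1
  rw [smul_inv'', div_eq_mul_inv, div_eq_mul_inv]
  field_simp
  ring

namespace IsRealCoroot

theorem inv_one_sub_expR_mem_stronglyRegularSubring (hβ : D.IsRealCoroot β)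
    (hne : β ≠ D.simpleCoroot i) (hne' : β ≠ -D.simpleCoroot i) :
    (1 - expR β)⁻¹ ∈ D.stronglyRegularSubring i :=
  inv_mem_stronglyRegularSubring (sub_mem (one_mem _) (expR_mem_stronglyRegularSubring β))
    (hβ.inv_one_sub_expR_mem_regularSubring hne hne')

theorem cFun_mem_stronglyRegularSubring (hβ : D.IsRealCoroot β)
    (hne : β ≠ D.simpleCoroot i) (hne' : β ≠ -D.simpleCoroot i) :
    cFun β ∈ D.stronglyRegularSubring i := by
  rw [cFun, div_eq_mul_inv]
  exact mul_mem (sub_mem (one_mem _)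
      (mul_mem vInvR_mem_stronglyRegularSubring (expR_mem_stronglyRegularSubring _)))
    (hβ.inv_one_sub_expR_mem_stronglyRegularSubring hne hne')

theorem bFun_mem_stronglyRegularSubring (hβ : D.IsRealCoroot β)
    (hne : β ≠ D.simpleCoroot i) (hne' : β ≠ -D.simpleCoroot i) :
    bFun β ∈ D.stronglyRegularSubring i := by
  rw [bFun, div_eq_mul_inv]
  exact mul_mem (sub_mem vInvR_mem_stronglyRegularSubring (one_mem _))
    (hβ.inv_one_sub_expR_mem_stronglyRegularSubring hne hne')

end IsRealCoroot

end StronglyRegularSubring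

end AffineDatum

namespace AffineDatum

variable {I : Type*} [Fintype I] [DecidableEq I] {D : AffineDatum I}

variable (D) in
/-- The rational functions `p` and `r` have at most simple poles along `e^{a_i} = 1`, and their
residues there are opposite. -/
structure OppositeResidues (i : I) (p r : RatFun I) : Prop where
  left_mem : (1 - expR (D.simpleCoroot i)) * p ∈ D.regularSubring i
  right_mem : (1 - expR (D.simpleCoroot i)) * r ∈ D.regularSubring i
  left_add_right_mem : p + r ∈ D.regularSubring i

namespace OppositeResidues

variable {i : I} {p r p' r' s : RatFun I}

theorem of_mem (hp : p ∈ D.regularSubring i) (hr : r ∈ D.regularSubring i) :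
    D.OppositeResidues i p r :=
  have h := sub_mem (one_mem _) (expR_mem_regularSubring _)
  ⟨mul_mem h hp, mul_mem h hr, add_mem hp hr⟩

theorem symm (h : D.OppositeResidues i p r) : D.OppositeResidues i r p :=
  ⟨h.right_mem, h.left_mem, add_comm p r ▸ h.left_add_right_mem⟩

theorem add (h : D.OppositeResidues i p r) (h' : D.OppositeResidues i p' r') :
    D.OppositeResidues i (p + p') (r + r') where
  left_mem := mul_add _ p p' ▸ add_mem h.left_mem h'.left_mem
  right_mem := mul_add _ r r' ▸ add_mem h.right_mem h'.right_mem
  left_add_right_mem := add_add_add_comm p p' r r' ▸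
    add_mem h.left_add_right_mem h'.left_add_right_mem

theorem mul_stronglyRegular (h : D.OppositeResidues i p r)
    (hs : s ∈ D.stronglyRegularSubring i) :
    D.OppositeResidues i (p * s) (r * D.refl i • s) where
  left_mem := mul_assoc _ p s ▸ mul_mem h.left_mem hs.1
  right_mem := mul_assoc _ r _ ▸ mul_mem h.right_mem (refl_smul_mem_regularSubring hs.1)
  left_add_right_mem := by
    have hne := one_sub_expR_ne_zero (D.isRealCoroot_simpleCoroot i).ne_zero
    convert sub_mem (mul_mem h.left_add_right_mem hs.1) (mul_mem h.right_mem hs.2) using 1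
    field_simp
    ring

theorem cFun_bFun (h : D.OppositeResidues i p r) :
    D.OppositeResidues i
      (r * cFun (-D.simpleCoroot i) + p * bFun (D.simpleCoroot i))
      (p * cFun (D.simpleCoroot i) + r * bFun (-D.simpleCoroot i)) := by
  have ha := (D.isRealCoroot_simpleCoroot i).ne_zero
  set a := D.simpleCoroot i
  have hexp := expR_ne_zero a
  have hne := one_sub_expR_ne_zero ha
  have hx : expR a ∈ D.regularSubring i := expR_mem_regularSubring a
  have hy : expR (-a) ∈ D.regularSubring i := expR_mem_regularSubring (-a)
  have hv : vInvR I ∈ D.regularSubring i := vInvR_mem_regularSubring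
  have hone := one_mem (D.regularSubring i)
  constructor
  · convert sub_mem (mul_mem (neg_mem (mul_mem hx (sub_mem hone (mul_mem hv hx))))
      h.left_add_right_mem) (mul_mem h.left_mem (sub_mem (sub_mem hone hv) (mul_mem hv hx))) using 1
    rw [cFun_neg_eq ha, bFun]
    field_simp
    ring
  · convert add_mem (mul_mem (sub_mem hone (mul_mem hv hy)) h.left_add_right_mem)
      (mul_mem h.right_mem (add_mem (sub_mem hv hone) (mul_mem hv hy))) using 1
    rw [cFun_eq ha, bFun_neg_eq ha, expR_neg]
    field_simp
    ring
  · convert add_mem (mul_mem (neg_mem (mul_mem hv hy)) h.left_add_right_mem)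
      (mul_mem h.right_mem (mul_mem (mul_mem hv (add_mem hone hx)) hy)) using 1
    rw [cFun_eq ha, cFun_neg_eq ha, bFun_neg_eq ha, bFun, expR_neg]
    field_simp
    ring

end OppositeResidues

/-- Elements `∑_u F_u [u]` of `R[W]` such that `F_u` and `F_{w_i u}` have opposite residues along
`e^{a_i} = 1` for all `u`. -/
def HasOppositeResidues (i : I) (F : D.RW) : Prop :=
  ∀ u, D.OppositeResidues i (F.coeff u) (F.coeff (D.refl i * u))

namespace HasOppositeResidues

variable {i : I} {F : D.RW}

theorem one : HasOppositeResidues i (1 : D.RW) := by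
  have hcoeff (u : D.weylGroup) : (1 : D.RW).coeff u ∈ D.regularSubring i := by
    classical
    rw [SkewMonoidAlgebra.coeff_one, Finsupp.single_apply]
    split_ifs
    exacts [one_mem _, zero_mem _]
  exact fun u => .of_mem (hcoeff u) (hcoeff _)

theorem mul_T_of_apply_eq (hF : HasOppositeResidues i F) {j : I} {u : D.weylGroup}
    (h : u.1 (D.simpleCoroot j) = D.simpleCoroot i) :
    D.OppositeResidues i ((F * D.T j).coeff u) ((F * D.T j).coeff (D.refl i * u)) := by
  have hcomm := D.mul_refl_eq_refl_mul (Or.inl h)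
  have hcomm' : D.refl i * u * D.refl j = u := by rw [← hcomm, mul_refl_mul_refl]
  convert (hF u).cFun_bFun using 1
  · rw [coeff_mul_T, hcomm, h]
  · rw [coeff_mul_T, hcomm', mul_apply, h, refl_simpleCoroot, neg_neg]

theorem mul_T (hF : HasOppositeResidues i F) (j : I) : HasOppositeResidues i (F * D.T j) := by
  intro u
  have hreal := D.isRealCoroot_apply_simpleCoroot u j
  by_cases hpos : u.1 (D.simpleCoroot j) = D.simpleCoroot i
  · exact hF.mul_T_of_apply_eq hpos
  by_cases hneg : u.1 (D.simpleCoroot j) = -D.simpleCoroot i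
  · have hflip := hF.mul_T_of_apply_eq (u := D.refl i * u) (j := j)
      (by rw [mul_apply, hneg, map_neg, refl_simpleCoroot, neg_neg])
    rw [refl_mul_refl_mul] at hflip
    exact hflip.symm
  have hc := hreal.neg.cFun_mem_stronglyRegularSubring (neg_eq_iff_eq_neg.not.mpr hneg)
    (neg_injective.ne hpos)
  have hb := hreal.bFun_mem_stronglyRegularSubring hpos hneg
  have h := ((hF (u * D.refl j)).mul_stronglyRegular hc).add ((hF u).mul_stronglyRegular hb)
  rw [smul_cFun, smul_bFun, map_neg, ← mul_assoc, ← mul_apply] at h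
  rwa [coeff_mul_T, coeff_mul_T]

end HasOppositeResidues

variable (D) in
theorem hasOppositeResidues_heckeBasis (i : I) (w : D.weylGroup) :
    HasOppositeResidues i (D.heckeBasis w) := by
  rw [heckeBasis]
  generalize (D.exists_isReduced_wordProd_eq w).choose = l
  induction l using List.reverseRecOn with
  | nil => exact .one
  | append_singleton l j ih =>
    rw [List.map_append, List.prod_append, List.map_singleton, List.prod_singleton]
    exact ih.mul_T j

end AffineDatum

/-! ### Left multiplication -/

theorem supportedBelow_one_sub_vInvS_mul_expS {I : Type*} {γ : I → ℤ} (h : γ ≤ 0) :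
    SupportedBelow 0 (1 - vInvS I * expS γ) := by
  have hexp := SupportedBelow.vInvS.mul (SupportedBelow.expS γ)
  rw [zero_add] at hexp
  exact SupportedBelow.one.sub (hexp.mono h)

theorem coeff_zero_one_sub_vInvS_mul_expS {I : Type*} {γ : I → ℤ} (h : γ ≠ 0) :
    (1 - vInvS I * expS γ).coeff 0 = 1 := by
  have hexp : (expS γ).coeff 0 = 0 := HahnSeries.coeff_single_of_ne fun h0 => h h0.symm
  rw [HahnSeries.coeff_sub, vInvS, HahnSeries.C_mul_eq_smul, HahnSeries.coeff_smul, hexp,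
    smul_zero, sub_zero, HahnSeries.coeff_one, if_pos rfl]

namespace AffineDatum

variable {I : Type*} [Fintype I] [DecidableEq I] (D : AffineDatum I)

theorem coeff_T_mul_heckeBasis_add (i : I) (u w : D.weylGroup) :
    (D.T i * (D.heckeBasis w + D.heckeBasis (D.refl i * w))).coeff u =
      vInvR I * (D.heckeBasis w + D.heckeBasis (D.refl i * w)).coeff u := by
  wlog h : 0 ≤ w⁻¹.1 (D.simpleCoroot i) generalizing w with H
  · have hflip := H (D.refl i * w) <| by
      simpa using (D.isRealCoroot_apply_simpleCoroot w⁻¹ i).not_nonneg_iff.mp h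
    rwa [refl_mul_refl_mul, add_comm] at hflip
  · rw [mul_add, D.heckeBasis_refl_mul h, SkewMonoidAlgebra.coeff_add,
      SkewMonoidAlgebra.coeff_add, Finsupp.add_apply, Finsupp.add_apply, coeff_T_mul_T_mul]
    ring

theorem smul_coeff_heckeBasis_add (i : I) (u w : D.weylGroup) :
    (1 - vInvR I * expR (-D.simpleCoroot i)) *
        D.refl i • (D.heckeBasis w + D.heckeBasis (D.refl i * w)).coeff (D.refl i * u) =
      (1 - vInvR I * expR (D.simpleCoroot i)) *
        (D.heckeBasis w + D.heckeBasis (D.refl i * w)).coeff u := by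
  have hne := one_sub_expR_ne_zero (D.isRealCoroot_simpleCoroot i).ne_zero
  have hT := D.coeff_T_mul_heckeBasis_add i u w
  rw [coeff_T_mul, cFun, bFun] at hT
  field_simp at hT
  linear_combination hT

theorem permuted_heckeCoeff_add (i : I) (u w : D.weylGroup) :
    Permuted (D.refl i)
      ((1 - expS (D.simpleCoroot i)) * (1 - vInvS I * expS (D.simpleCoroot i)) *
        (D.heckeCoeff (D.refl i * u) w + D.heckeCoeff (D.refl i * u) (D.refl i * w)))
      ((1 - expS (-D.simpleCoroot i)) * (1 - vInvS I * expS (D.simpleCoroot i)) *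
        (D.heckeCoeff u w + D.heckeCoeff u (D.refl i * w))) := by
  set a := D.simpleCoroot i with ha
  have hexpand (γ : I → ℤ) (u : D.weylGroup) :=
    ((IsExpansion.one.sub (.expR γ)).mul (IsExpansion.one.sub (.mul .vInvR (.expR a)))).mul
      (D.isExpansion_coeff_heckeBasis_add u w (D.refl i * w))
  refine permuted_of_mem_regularSubring ?_ (hexpand a (D.refl i * u)) ?_
  · have hpole (w : D.weylGroup) := (D.hasOppositeResidues_heckeBasis i w (D.refl i * u)).left_mem
    convert mul_mem (sub_mem (one_mem _) (mul_mem vInvR_mem_regularSubring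
      (expR_mem_regularSubring a))) (add_mem (hpole w) (hpole (D.refl i * w))) using 1
    rw [SkewMonoidAlgebra.coeff_add, Finsupp.add_apply]
    ring
  · convert hexpand (-a) u using 1
    simp only [smul_mul', smul_sub, smul_one, smul_expR, smul_vInvR, ha, refl_simpleCoroot]
    linear_combination (1 - expR (-D.simpleCoroot i)) * D.smul_coeff_heckeBasis_add i u w

theorem permuted_symmetrizer (i : I) (u : D.weylGroup) :
    Permuted (D.refl i)
      ((1 - expS (D.simpleCoroot i)) * (1 - vInvS I * expS (D.simpleCoroot i)) *
        D.symmetrizer (D.refl i * u))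
      ((1 - expS (-D.simpleCoroot i)) * (1 - vInvS I * expS (D.simpleCoroot i)) *
        D.symmetrizer u) := by
  intro γ
  have hfin := D.hasFiniteSupport_coeff_mul_heckeCoeff
  rw [coeff_mul_symmetrizer, coeff_mul_symmetrizer, ← sub_eq_zero,
    ← finsum_sub_distrib (hfin _ _ _) (hfin _ _ _)]
  refine finsum_eq_zero_of_add_apply_eq_zero (Equiv.mulLeft (D.refl i))
    ((hfin _ _ _).sub (hfin _ _ _)) fun w => ?_
  have hpair := D.permuted_heckeCoeff_add i u w γ
  simp only [mul_add, HahnSeries.coeff_add] at hpair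
  rw [Equiv.coe_mulLeft]
  linear_combination hpair

theorem isTransform_one (f : CorootSeries I) : D.IsTransform 1 f f :=
  ⟨1, one_ne_zero, fun γ => by rw [one_smul]; rfl⟩

section Ratio

variable {D} {i : I} {ρ : CorootSeries I}

theorem isTransform_symmetrizer
    (hρ : (1 - vInvS I * expS (-D.simpleCoroot i)) * ρ = 1 - vInvS I * expS (D.simpleCoroot i))
    (u : D.weylGroup) :
    D.IsTransform (D.refl i) (D.symmetrizer (D.refl i * u)) (ρ * D.symmetrizer u) := by
  refine ⟨(1 - expA (D.simpleCoroot i)) * (1 - vInvA I * expA (D.simpleCoroot i)),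
    mul_ne_zero (one_sub_expA_ne_zero (D.isRealCoroot_simpleCoroot i).ne_zero)
      (one_sub_vInvA_mul_expA_ne_zero _), fun γ => ?_⟩
  simp only [smul_mul', smul_sub, smul_one, smul_expA, smul_vInvA, refl_simpleCoroot, map_mul,
    map_sub, map_one, toSeries_expA, toSeries_vInvA]
  rw [← D.permuted_symmetrizer i u γ]
  refine congrArg (fun f : CorootSeries I => f.coeff (OrderDual.toDual ((D.refl i).1 γ))) ?_
  linear_combination (1 - expS (-D.simpleCoroot i)) * D.symmetrizer u * hρ

theorem isExpansion_ratio
    (hρ : (1 - vInvS I * expS (-D.simpleCoroot i)) * ρ = 1 - vInvS I * expS (D.simpleCoroot i)) :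
    IsExpansion ((1 - vInvR I * expR (D.simpleCoroot i)) /
      (1 - vInvR I * expR (-D.simpleCoroot i))) ρ := by
  refine ⟨1 - vInvA I * expA (D.simpleCoroot i), 1 - vInvA I * expA (-D.simpleCoroot i),
    one_sub_vInvA_mul_expA_ne_zero _, ?_, ?_⟩
  · simp only [map_sub, map_mul, map_one, algebraMap_expA, algebraMap_vInvA]
    exact div_mul_cancel₀ _ (one_sub_vInvR_mul_expR_ne_zero _)
  · simpa only [map_sub, map_mul, map_one, toSeries_expA, toSeries_vInvA, mul_comm ρ] using hρ

theorem expansion_cFun_mul_ratio_add_expansion_bFun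
    (hρ : (1 - vInvS I * expS (-D.simpleCoroot i)) * ρ = 1 - vInvS I * expS (D.simpleCoroot i))
    {c b : CorootSeries I} (hc : IsExpansion (cFun (D.simpleCoroot i)) c)
    (hb : IsExpansion (bFun (D.simpleCoroot i)) b) : c * ρ + b = vInvS I := by
  refine ((hc.mul (isExpansion_ratio hρ)).add hb).unique ?_
  convert IsExpansion.vInvR (I := I) using 1
  have := one_sub_expR_ne_zero (D.isRealCoroot_simpleCoroot i).ne_zero
  have := one_sub_vInvR_mul_expR_ne_zero (-D.simpleCoroot i)
  rw [cFun, bFun]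
  field_simp
  ring

end Ratio

theorem exists_ratio (i : I) : ∃ ρ : CorootSeries I,
    (1 - vInvS I * expS (-D.simpleCoroot i)) * ρ = 1 - vInvS I * expS (D.simpleCoroot i) := by
  have hneg : -D.simpleCoroot i ≤ 0 := neg_nonpos.mpr (D.simpleCoroot_nonneg i)
  have hne : -D.simpleCoroot i ≠ 0 := neg_ne_zero.mpr (D.isRealCoroot_simpleCoroot i).ne_zero
  obtain ⟨g, -, hinv⟩ := (supportedBelow_one_sub_vInvS_mul_expS hneg).exists_inverse
    (coeff_zero_one_sub_vInvS_mul_expS hne)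
  exact ⟨g * (1 - vInvS I * expS (D.simpleCoroot i)), by rw [← mul_assoc, hinv, one_mul]⟩

theorem isLeftProd_T_symmetrizer (i : I) :
    D.IsLeftProd (D.T i) D.symmetrizer (fun u => vInvS I * D.symmetrizer u) := by
  classical
  have hreal := D.isRealCoroot_simpleCoroot i
  obtain ⟨ρ, hρ⟩ := D.exists_ratio i
  obtain ⟨c, hc, -⟩ := exists_isExpansion_cFun hreal.nonneg_or_nonpos hreal.ne_zero
  obtain ⟨b, hb, -⟩ := exists_isExpansion_bFun hreal.nonneg_or_nonpos hreal.ne_zero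
  have hne := (D.refl_ne_one i).symm
  refine ⟨Function.update (fun _ => b) (D.refl i) c,
    Function.update (fun _ => D.symmetrizer) (D.refl i) (fun u => ρ * D.symmetrizer u),
    D.forall_mem_support_T.mpr ⟨?_, ?_⟩,
    D.forall_mem_support_T.mpr ⟨fun u => ?_, fun u => ?_⟩, fun u => ?_⟩
  · rw [Function.update_self, coeff_T_refl]
    exact hc
  · rw [Function.update_of_ne hne, coeff_T_one]
    exact hb
  · rw [Function.update_self, refl_inv]
    exact isTransform_symmetrizer hρ u
  · rw [Function.update_of_ne hne, inv_one, one_mul]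
    exact D.isTransform_one _
  · simp only [sum_support_T, Function.update_self, Function.update_of_ne hne]
    rw [← expansion_cFun_mul_ratio_add_expansion_bFun hρ hc hb]
    ring

variable {D}

theorem isLeftProd_single {w : D.weylGroup} {r : RatFun I} {f : CorootSeries I} (hr : r ≠ 0)
    (hf : IsExpansion r f) {F G : D.weylGroup → CorootSeries I}
    (h : ∀ u, D.IsTransform w (F (w⁻¹ * u)) (G u)) :
    D.IsLeftProd (SkewMonoidAlgebra.single w r) F (fun u => f * G u) := by
  have hsupp : (SkewMonoidAlgebra.single w r : D.RW).support = {w} :=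
    SkewMonoidAlgebra.support_single w hr
  refine ⟨fun _ => f, fun _ => G, ?_, ?_, fun u => by rw [hsupp, Finset.sum_singleton]⟩ <;>
    rw [hsupp] <;> simp only [Finset.mem_singleton, forall_eq]
  · rwa [SkewMonoidAlgebra.coeff_single, Finsupp.single_eq_same]
  · exact h

theorem isLeftProd_single_one {w : D.weylGroup} {F G : D.weylGroup → CorootSeries I}
    (h : ∀ u, D.IsTransform w (F (w⁻¹ * u)) (G u)) :
    D.IsLeftProd (SkewMonoidAlgebra.single w 1) F G := by
  simpa only [one_mul] using isLeftProd_single one_ne_zero .one h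

variable (D)

theorem exists_isLeftProd_refl_symmetrizer (i : I) : ∃ G : D.weylGroup → CorootSeries I,
    D.IsLeftProd (SkewMonoidAlgebra.single (D.refl i) 1) D.symmetrizer G ∧
    D.IsLeftProd (SkewMonoidAlgebra.single 1
      ((1 - vInvR I * expR (D.simpleCoroot i)) /
        (1 - vInvR I * expR (-D.simpleCoroot i)))) D.symmetrizer G := by
  obtain ⟨ρ, hρ⟩ := D.exists_ratio i
  refine ⟨fun u => ρ * D.symmetrizer u, isLeftProd_single_one fun u => ?_,
    isLeftProd_single ?_ (isExpansion_ratio hρ) fun u => ?_⟩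
  · rw [refl_inv]
    exact isTransform_symmetrizer hρ u
  · exact div_ne_zero (one_sub_vInvR_mul_expR_ne_zero _) (one_sub_vInvR_mul_expR_ne_zero _)
  · rw [inv_one, one_mul]
    exact D.isTransform_one _

end AffineDatum

/-! ### Infinite products of series -/

section InfiniteProduct

variable {I : Type*}

/-- The family `F` is multipliable with product `f` for coefficientwise stabilization: each
coefficient of the product over a sufficiently large finite set is that of `f`. -/
def IsCoeffwiseProd {ι : Type*} (F : ι → CorootSeries I) (f : CorootSeries I) : Prop :=
  ∀ γ : I → ℤ, ∀ᶠ t : Finset ι in Filter.atTop,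
    (∏ δ ∈ t, F δ).coeff (OrderDual.toDual γ) = f.coeff (OrderDual.toDual γ)

theorem coeff_one_sub_vInvS_mul_expS_mul (β γ : I → ℤ) (f : CorootSeries I) :
    ((1 - vInvS I * expS β) * f).coeff (OrderDual.toDual γ) =
      f.coeff (OrderDual.toDual γ) - X * f.coeff (OrderDual.toDual (γ - β)) := by
  have hshift : (expS β * f).coeff (OrderDual.toDual γ) =
      f.coeff (OrderDual.toDual (γ - β)) := by
    have hmul := HahnSeries.coeff_single_mul_add (r := (1 : ℂ[X])) (x := f)
      (a := OrderDual.toDual (γ - β)) (b := OrderDual.toDual β)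
    rwa [← toDual_add, sub_add_cancel, one_mul] at hmul
  rw [sub_mul, one_mul, mul_assoc, HahnSeries.coeff_sub, vInvS, HahnSeries.C_mul_eq_smul,
    HahnSeries.coeff_smul, hshift, smul_eq_mul]

theorem coeff_mul_eq_of_not_le {f g : CorootSeries I} {γ δ : I → ℤ}
    (hf : SupportedBelow (-δ) (f - 1)) (hg : SupportedBelow 0 g) (h : ¬ δ ≤ -γ) :
    (f * g).coeff (OrderDual.toDual γ) = g.coeff (OrderDual.toDual γ) := by
  have hsupp := hf.mul hg
  rw [add_zero, sub_mul, one_mul] at hsupp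
  rw [← sub_eq_zero, ← HahnSeries.coeff_sub]
  exact not_not.mp fun hne => h (le_neg_of_le_neg (hsupp γ hne))

theorem IsCoeffwiseProd.eq_one_sub_mul {ι : Type*} [DecidableEq ι] {F : ι → CorootSeries I}
    {f g : CorootSeries I} {j : ι} {β : I → ℤ} (hf : IsCoeffwiseProd F f)
    (hg : IsCoeffwiseProd (Function.update F j 1) g) (hj : F j = 1 - vInvS I * expS β) :
    f = (1 - vInvS I * expS β) * g := by
  ext x : 2
  obtain ⟨γ, rfl⟩ := OrderDual.toDual.surjective x
  obtain ⟨t, ⟨hft, hγ, hβ⟩, hjt⟩ := ((hf γ).and ((hg γ).and (hg (γ - β)))).and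
    (Filter.eventually_ge_atTop {j}) |>.exists
  have hjt : j ∈ t := Finset.singleton_subset_iff.mp hjt
  rw [← hft, coeff_one_sub_vInvS_mul_expS_mul, ← hγ, ← hβ, ← coeff_one_sub_vInvS_mul_expS_mul,
    ← hj, Finset.prod_update_of_mem hjt, one_mul, Finset.sdiff_singleton_eq_erase,
    Finset.mul_prod_erase t F hjt]

variable [Fintype I] [DecidableEq I]

/-- The product of the family `F` over the cone of all `δ ≥ 0`, where only the factors with
`δ ≤ -γ` are taken into account for the coefficient of `e^γ`. -/
def coneProd (F : (I → ℤ) → CorootSeries I) : CorootSeries I where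
  coeff x := (∏ δ ∈ Finset.Icc 0 (-OrderDual.ofDual x), F δ).coeff x
  isPWO_support' := isPWO_Iic_zero.mono fun x hx => by
    by_contra hpos
    rw [Function.mem_support, Finset.Icc_eq_empty (by simpa using hpos), Finset.prod_empty] at hx
    exact hx (coeff_one_of_ne_zero fun h0 => hpos (le_of_eq h0))

variable {F : (I → ℤ) → CorootSeries I}

theorem supportedBelow_coneProd : SupportedBelow 0 (coneProd F) := by
  intro γ hγ
  by_contra hpos
  refine hγ ?_
  change (∏ δ ∈ Finset.Icc 0 (-γ), F δ).coeff (OrderDual.toDual γ) = 0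
  rw [Finset.Icc_eq_empty (by simpa using hpos), Finset.prod_empty]
  exact coeff_one_of_ne_zero fun h0 => hpos h0.le

theorem coeff_zero_coneProd : (coneProd F).coeff 0 = (F 0).coeff 0 := by
  change (∏ δ ∈ Finset.Icc 0 (-0), F δ).coeff 0 = _
  rw [neg_zero, Finset.Icc_self, Finset.prod_singleton]

theorem isCoeffwiseProd_coneProd
    (hF : ∀ δ, F δ = 1 ∨ 0 ≤ δ ∧ SupportedBelow (-δ) (F δ - 1)) :
    IsCoeffwiseProd F (coneProd F) := by
  have hsupp (δ : I → ℤ) : SupportedBelow 0 (F δ) := by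
    rcases hF δ with h | ⟨hδ, h⟩
    · rw [h]
      exact SupportedBelow.one
    · simpa only [sub_add_cancel] using (h.mono (neg_nonpos.mpr hδ)).add SupportedBelow.one
  have hprod (s : Finset (I → ℤ)) : SupportedBelow 0 (∏ δ ∈ s, F δ) :=
    Finset.prod_induction F _ (fun f g hf hg => by simpa only [add_zero] using hf.mul hg)
      SupportedBelow.one fun δ _ => hsupp δ
  intro γ
  have hdrop (s : Finset (I → ℤ)) (hs : Disjoint s (Finset.Icc 0 (-γ))) {g : CorootSeries I}
      (hg : SupportedBelow 0 g) :
      ((∏ δ ∈ s, F δ) * g).coeff (OrderDual.toDual γ) = g.coeff (OrderDual.toDual γ) := by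
    induction s using Finset.induction_on with
    | empty => rw [Finset.prod_empty, one_mul]
    | insert δ s hδs ih =>
      rw [Finset.disjoint_insert_left] at hs
      rw [← ih hs.2, Finset.prod_insert hδs, mul_assoc]
      rcases hF δ with h | ⟨hδ, h⟩
      · rw [h, one_mul]
      · refine coeff_mul_eq_of_not_le h (by simpa only [add_zero] using (hprod s).mul hg) ?_
        exact fun hle => hs.1 (Finset.mem_Icc.mpr ⟨hδ, hle⟩)
  filter_upwards [Filter.eventually_ge_atTop (Finset.Icc 0 (-γ))] with t ht
  rw [← Finset.prod_sdiff ht]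
  exact hdrop _ Finset.sdiff_disjoint (hprod _)

end InfiniteProduct

namespace AffineDatum

variable {I : Type*} [Fintype I] [DecidableEq I] {D : AffineDatum I}

theorem Permuted.pow {w : D.weylGroup} {f g : CorootSeries I} (h : Permuted w f g) (m : ℕ) :
    Permuted w (f ^ m) (g ^ m) := by
  induction m with
  | zero => simpa only [pow_zero] using Permuted.one
  | succ m ih => simpa only [pow_succ] using ih.mul h

theorem Permuted.of_isCoeffwiseProd {ι κ : Type*} {w : D.weylGroup} {F : ι → CorootSeries I}
    {G : κ → CorootSeries I} {f g : CorootSeries I} (hf : IsCoeffwiseProd F f)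
    (hg : IsCoeffwiseProd G g) (e : ι ≃ κ) (h : ∀ j, Permuted w (F j) (G (e j))) :
    Permuted w f g := by
  classical
  intro γ
  have htendsto : Filter.Tendsto (Finset.image e) Filter.atTop Filter.atTop :=
    Filter.tendsto_finset_image_atTop_atTop (i := e.symm) e.right_inv
  obtain ⟨t, hft, hgt⟩ := ((hf γ).and (htendsto.eventually (hg (w.1 γ)))).exists
  rw [← hft, ← hgt, Finset.prod_image e.injective.injOn]
  exact Finset.prod_hom_rel Permuted.one (fun j _ _ hab => (h j).mul hab) γ

/-! ### The product `𝔇_v` -/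

variable (D) in
/-- The factor `(1 - v⁻¹ e^{-γ})^{m(γ)}` of `𝔇_v`. -/
def rootFactor (γ : I → ℤ) : CorootSeries I := (1 - vInvS I * expS (-γ)) ^ D.mult γ

variable (D) in
theorem supportedBelow_rootFactor_sub_one {δ : I → ℤ} (hδ : 0 ≤ δ) :
    SupportedBelow (-δ) (D.rootFactor δ - 1) := by
  rw [rootFactor]
  have hexp := SupportedBelow.vInvS.mul (SupportedBelow.expS (-δ))
  rw [zero_add] at hexp
  induction D.mult δ with
  | zero =>
    rw [pow_zero, sub_self]
    exact fun γ hγ => absurd rfl hγ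
  | succ m ih =>
    have hstep := (supportedBelow_one_sub_vInvS_mul_expS (neg_nonpos.mpr hδ)).mul ih
    rw [zero_add] at hstep
    convert hstep.sub hexp using 1
    ring

theorem isRealCoroot_apply_iff {w : D.weylGroup} {γ : I → ℤ} :
    D.IsRealCoroot (w.1 γ) ↔ D.IsRealCoroot γ :=
  ⟨fun h => by simpa using h.apply w⁻¹, fun h => h.apply w⟩

variable (D) in
theorem permuted_rootFactor (w : D.weylGroup) (γ : I → ℤ) :
    Permuted w (D.rootFactor γ) (D.rootFactor (w.1 γ)) := by
  have hmult : D.mult (w.1 γ) = D.mult γ := by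
    classical exact if_congr isRealCoroot_apply_iff rfl rfl
  have hbase := Permuted.toSeries w (1 - vInvA I * expA (-γ))
  simp only [smul_sub, smul_one, smul_mul', smul_vInvA, smul_expA, map_neg, map_sub, map_mul,
    map_one, toSeries_expA, toSeries_vInvA] at hbase
  rw [rootFactor, rootFactor, hmult]
  exact hbase.pow _

variable (D) in
/-- The product of the factors `(1 - v⁻¹ e^{-γ})^{m(γ)}` over a set `Q` of vectors `γ ≥ 0`. -/
def rootProd (Q : Set (I → ℤ)) : CorootSeries I := coneProd (Q.mulIndicator D.rootFactor)

section RootProd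

variable {Q : Set (I → ℤ)}

theorem supportedBelow_rootProd : SupportedBelow 0 (D.rootProd Q) := supportedBelow_coneProd

theorem coeff_zero_rootProd (hQ : 0 ∉ Q) : (D.rootProd Q).coeff 0 = 1 := by
  rw [rootProd, coeff_zero_coneProd, Set.mulIndicator_of_notMem hQ, HahnSeries.coeff_one,
    if_pos rfl]

variable (D) in
theorem isCoeffwiseProd_rootProd (hQ : ∀ δ ∈ Q, 0 ≤ δ) :
    IsCoeffwiseProd (Q.mulIndicator D.rootFactor) (D.rootProd Q) := by
  refine isCoeffwiseProd_coneProd fun δ => ?_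
  by_cases hδ : δ ∈ Q
  · rw [Set.mulIndicator_of_mem hδ]
    exact .inr ⟨hQ δ hδ, D.supportedBelow_rootFactor_sub_one (hQ δ hδ)⟩
  · exact .inl (Set.mulIndicator_of_notMem hδ _)

theorem rootProd_eq_one_sub_mul (hQ : ∀ δ ∈ Q, 0 ≤ δ) {α : I → ℤ} (hα : α ∈ Q)
    (hreal : D.IsRealCoroot α) :
    D.rootProd Q = (1 - vInvS I * expS (-α)) * D.rootProd (Q \ {α}) := by
  classical
  have hupdate : Function.update (Q.mulIndicator D.rootFactor) α 1 =
      (Q \ {α}).mulIndicator D.rootFactor := by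
    ext1 δ
    by_cases hδ : δ = α <;> simp [Set.mulIndicator_apply, hδ]
  refine (D.isCoeffwiseProd_rootProd hQ).eq_one_sub_mul (j := α) ?_ ?_
  · rw [hupdate]
    exact D.isCoeffwiseProd_rootProd fun δ hδ => hQ δ hδ.1
  · rw [Set.mulIndicator_of_mem hα, rootFactor, mult, if_pos hreal, pow_one]

theorem permuted_rootProd {w : D.weylGroup} (hQ : ∀ δ ∈ Q, 0 ≤ δ)
    (hw : ∀ δ, w.1 δ ∈ Q ↔ δ ∈ Q) : Permuted w (D.rootProd Q) (D.rootProd Q) := by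
  have hprod := D.isCoeffwiseProd_rootProd hQ
  refine .of_isCoeffwiseProd hprod hprod w.1.toEquiv fun δ => ?_
  change Permuted w _ (Q.mulIndicator D.rootFactor (w.1 δ))
  by_cases hδ : δ ∈ Q
  · rw [Set.mulIndicator_of_mem hδ, Set.mulIndicator_of_mem ((hw δ).mpr hδ)]
    exact D.permuted_rootFactor w δ
  · rw [Set.mulIndicator_of_notMem hδ, Set.mulIndicator_of_notMem (mt (hw δ).mp hδ)]
    exact Permuted.one

end RootProd

variable (D) in
/-- The set of the positive coroots, real and imaginary. -/
def posCoroots : Set (I → ℤ) := {γ | D.IsPosCoroot γ}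

variable (D) in
theorem Dv_eq_rootProd : D.Dv = D.rootProd D.posCoroots := by
  have hpartial (β : I → ℤ) : D.partialProd β =
      ∏ δ ∈ Finset.Icc 0 β, D.posCoroots.mulIndicator D.rootFactor δ := by
    rw [partialProd, Finset.prod_filter]
    refine Finset.prod_congr rfl fun δ _ => ?_
    by_cases hδ : D.IsPosCoroot δ
    · exact (if_pos hδ).trans (Set.mulIndicator_of_mem (s := D.posCoroots) hδ D.rootFactor).symm
    · exact (if_neg hδ).trans (Set.mulIndicator_of_notMem (s := D.posCoroots) hδ D.rootFactor).symm
  ext1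
  funext x
  have hcoeff : D.Dv.coeff x = (D.partialProd (-OrderDual.ofDual x)).coeff x := rfl
  rw [hcoeff, hpartial]
  rfl

theorem IsPosCoroot.nonneg {γ : I → ℤ} (h : D.IsPosCoroot γ) : 0 ≤ γ := by
  rcases h with ⟨-, h⟩ | ⟨n, -, rfl⟩
  · exact h
  · exact nsmul_nonneg (fun i => (D.c_pos i).le) n

theorem zero_notMem_posCoroots : 0 ∉ D.posCoroots := by
  rintro (⟨h, -⟩ | ⟨n, hn, h⟩)
  · exact h.ne_zero rfl
  · obtain ⟨i⟩ := D.nonempty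
    exact (nsmul_pos (D.c_pos i) hn.ne').ne (congrFun h i)

theorem simpleCoroot_mem_posCoroots (i : I) : D.simpleCoroot i ∈ D.posCoroots :=
  .inl ⟨D.isRealCoroot_simpleCoroot i, D.simpleCoroot_nonneg i⟩

theorem refl_apply_mem_posCoroots_diff {γ : I → ℤ} {i : I}
    (h : γ ∈ D.posCoroots \ {D.simpleCoroot i}) :
    (D.refl i).1 γ ∈ D.posCoroots \ {D.simpleCoroot i} := by
  refine ⟨?_, fun hflip => ?_⟩
  · rcases h.1 with ⟨hreal, hγ⟩ | ⟨n, hn, rfl⟩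
    · exact .inl ⟨hreal.apply _, hreal.refl_nonneg hγ h.2⟩
    · exact .inr ⟨n, hn, by rw [map_nsmul, apply_c]⟩
  · have hneg : γ = -D.simpleCoroot i := by
      rw [← refl_simpleCoroot, ← Set.mem_singleton_iff.mp hflip, refl_refl_apply]
    exact D.not_simpleCoroot_nonpos i (neg_nonneg.mp (hneg ▸ h.1.nonneg))

theorem refl_apply_mem_posCoroots_diff_iff {γ : I → ℤ} {i : I} :
    (D.refl i).1 γ ∈ D.posCoroots \ {D.simpleCoroot i} ↔
      γ ∈ D.posCoroots \ {D.simpleCoroot i} :=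
  ⟨fun h => by simpa only [refl_refl_apply] using refl_apply_mem_posCoroots_diff h,
    refl_apply_mem_posCoroots_diff⟩

variable (D)

theorem exists_inverse_Dv : ∃ g, SupportedBelow 0 g ∧ D.Dv * g = 1 := by
  rw [Dv_eq_rootProd]
  exact supportedBelow_rootProd.exists_inverse (coeff_zero_rootProd zero_notMem_posCoroots)

theorem isUnit_Dv : IsUnit D.Dv :=
  have ⟨g, _, hg⟩ := D.exists_inverse_Dv
  .of_mul_eq_one g hg

theorem supportedBelow_inverse_Dv : SupportedBelow 0 (Ring.inverse D.Dv) := by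
  obtain ⟨g, hsupp, hg⟩ := D.exists_inverse_Dv
  rwa [← mul_one (Ring.inverse D.Dv), ← hg, Ring.inverse_mul_cancel_left _ _ D.isUnit_Dv]

theorem supportedBelow_inverse_Dv_mul_symmetrizer (u : D.weylGroup) :
    SupportedBelow 0 (Ring.inverse D.Dv * D.symmetrizer u) := by
  simpa only [add_zero] using D.supportedBelow_inverse_Dv.mul (D.supportedBelow_symmetrizer u)

-- `(1 - v⁻¹ e^{-a_i}) 𝔇_v⁻¹` is the inverse of the product over the positive coroots other than
-- `a_i`, which are permuted by `w_i`.
theorem permuted_mul_inverse_Dv (i : I) :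
    Permuted (D.refl i)
      ((1 - vInvS I * expS (-D.simpleCoroot i)) * Ring.inverse D.Dv)
      ((1 - vInvS I * expS (-D.simpleCoroot i)) * Ring.inverse D.Dv) := by
  have hperm : Permuted (D.refl i) (D.rootProd (D.posCoroots \ {D.simpleCoroot i}))
      (D.rootProd (D.posCoroots \ {D.simpleCoroot i})) :=
    permuted_rootProd (fun δ hδ => hδ.1.nonneg) fun δ => refl_apply_mem_posCoroots_diff_iff
  have hinv : D.rootProd (D.posCoroots \ {D.simpleCoroot i}) *
      ((1 - vInvS I * expS (-D.simpleCoroot i)) * Ring.inverse D.Dv) = 1 := by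
    rw [← mul_assoc, mul_comm (D.rootProd _), ← rootProd_eq_one_sub_mul (fun δ hδ => hδ.nonneg)
      (simpleCoroot_mem_posCoroots i) (D.isRealCoroot_simpleCoroot i), ← Dv_eq_rootProd,
      Ring.mul_inverse_cancel _ D.isUnit_Dv]
  have hsupp := (supportedBelow_one_sub_vInvS_mul_expS (neg_nonpos.mpr
    (D.simpleCoroot_nonneg i))).mul D.supportedBelow_inverse_Dv
  rw [add_zero] at hsupp
  exact hperm.inverse supportedBelow_rootProd supportedBelow_rootProd
    (coeff_zero_rootProd fun h => zero_notMem_posCoroots h.1) hsupp hinv hinv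

/-! ### Invariance under the Weyl group -/

variable {D}

theorem IsTransform.trans {w w' : D.weylGroup} {f g h : CorootSeries I}
    (hfg : D.IsTransform w f g) (hgh : D.IsTransform w' g h) : D.IsTransform (w' * w) f h := by
  obtain ⟨d, hd, hfg⟩ := hfg
  obtain ⟨d', hd', hgh⟩ := hgh
  refine ⟨d * w⁻¹ • d', mul_ne_zero hd ((smul_ne_zero_iff_ne _).mpr hd'), ?_⟩
  have hfirst := (Permuted.toSeries w (w⁻¹ • d')).mul (show Permuted w _ _ from hfg)
  have hsecond := (Permuted.toSeries w' (w • d)).mul (show Permuted w' _ _ from hgh)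
  rw [smul_inv_smul] at hfirst
  rw [mul_left_comm] at hsecond
  have hleft : toSeries I (d * w⁻¹ • d') * f = toSeries I (w⁻¹ • d') * (toSeries I d * f) := by
    rw [map_mul]
    ring
  have hright : toSeries I ((w' * w) • (d * w⁻¹ • d')) * h =
      toSeries I (w' • w • d) * (toSeries I (w' • d') * h) := by
    rw [smul_mul', mul_smul, mul_smul, smul_inv_smul, map_mul, mul_assoc]
  change Permuted (w' * w) _ _
  rw [hleft, hright]
  exact hfirst.trans hsecond

variable (D)

theorem isTransform_refl_inverse_Dv_mul_symmetrizer (i : I) (u : D.weylGroup) :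
    D.IsTransform (D.refl i) (Ring.inverse D.Dv * D.symmetrizer (D.refl i * u))
      (Ring.inverse D.Dv * D.symmetrizer u) := by
  refine ⟨(1 - expA (D.simpleCoroot i)) * (1 - vInvA I * expA (D.simpleCoroot i)) *
    (1 - vInvA I * expA (-D.simpleCoroot i)),
    mul_ne_zero (mul_ne_zero
      (one_sub_expA_ne_zero (D.isRealCoroot_simpleCoroot i).ne_zero)
      (one_sub_vInvA_mul_expA_ne_zero _)) (one_sub_vInvA_mul_expA_ne_zero _), ?_⟩
  change Permuted (D.refl i) _ _
  have hperm := (D.permuted_mul_inverse_Dv i).mul (D.permuted_symmetrizer i u)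
  simp only [smul_mul', smul_sub, smul_one, smul_expA, smul_vInvA, map_neg, refl_simpleCoroot,
    neg_neg, map_mul, map_sub, map_one, toSeries_expA, toSeries_vInvA]
  convert hperm using 1 <;> ring

theorem isTransform_inverse_Dv_mul_symmetrizer (w u : D.weylGroup) :
    D.IsTransform w (Ring.inverse D.Dv * D.symmetrizer (w⁻¹ * u))
      (Ring.inverse D.Dv * D.symmetrizer u) := by
  induction w using D.weyl_induction_right generalizing u with
  | one =>
    rw [inv_one, one_mul]
    exact D.isTransform_one _
  | mul_refl w i ih =>
    rw [mul_inv_rev, refl_inv, mul_assoc]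
    exact (D.isTransform_refl_inverse_Dv_mul_symmetrizer i (w⁻¹ * u)).trans (ih u)

end AffineDatum

end

theorem lemma5p6 {I : Type*} [Fintype I] [DecidableEq I] (D : AffineDatum I) :
    (∃! P : D.weylGroup → CorootSeries I, D.IsSymmetrizer P) ∧
    IsUnit D.Dv ∧
    ∀ P : D.weylGroup → CorootSeries I, D.IsSymmetrizer P →
      (∀ u, P u ∈ QFin I) ∧
      (∀ i : I, D.IsLeftProd (D.T i) P (fun u => vInvS I * P u)) ∧
      (∀ i : I, D.IsRightProd P (D.T i) (fun u => vInvS I * P u)) ∧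
      (∀ i : I, ∃ G : D.weylGroup → CorootSeries I,
        D.IsLeftProd (SkewMonoidAlgebra.single (D.refl i) 1) P G ∧
        D.IsLeftProd (SkewMonoidAlgebra.single 1
          ((1 - vInvR I * expR (D.simpleCoroot i)) /
            (1 - vInvR I * expR (-D.simpleCoroot i)))) P G) ∧
      (∀ u, Ring.inverse D.Dv * P u ∈ QFin I) ∧
      (∀ w : D.weylGroup,
        D.IsLeftProd (SkewMonoidAlgebra.single w 1)
          (fun u => Ring.inverse D.Dv * P u) (fun u => Ring.inverse D.Dv * P u)) := by
  refine ⟨⟨D.symmetrizer, D.isSymmetrizer_symmetrizer, fun P hP => hP.eq_symmetrizer⟩,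
    D.isUnit_Dv, fun P hP => ?_⟩
  obtain rfl := hP.eq_symmetrizer
  exact ⟨D.supportedBelow_symmetrizer, D.isLeftProd_T_symmetrizer, D.isRightProd_T_symmetrizer,
    D.exists_isLeftProd_refl_symmetrizer, D.supportedBelow_inverse_Dv_mul_symmetrizer,
    fun w => AffineDatum.isLeftProd_single_one (D.isTransform_inverse_Dv_mul_symmetrizer w)⟩
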